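/- **Theorem (Higher order derivatives of Pfaffians).** Let $P,Q,L,d\ge 0$ be integers with $P+Q$ positive and even, let $\chi_1,\dots,\chi_L\in\mathbb C$ be pairwise distinct, and let $\psi:\{1,\dots,P\}\to\{1,\dots,L\}$ be surjective, with $P_l=|\psi^{-1}(l)|$. Let $n_1,\dots,n_P\in\{0,\dots,d\}$, and let $m_{l,k}=|\{i:\psi(i)=l,\ n_i=k\}|$. Let $C=-C^T$ be a complex $Q\times Q$ matrix, let $A:\mathbb C^2\to\mathbb C$ satisfy $A(x,y)=-A(y,x)$ and be analytic at all points $(\chi_l,\chi_{l'})$, and let $B_1,\dots,B_Q:\mathbb C\to\mathbb C$ be analytic at all points $\chi_l$. Write $\Delta_P(\vec x)=\prod_{1\le k<j\le P}(x_j-x_k)$. For $\boldsymbol u=(u_{l,j})_{1\le l\le L,\,1\le j\le d}$ and $\alpha=1,\dots,P$ define $$F_l(\boldsymbol u,\zeta)=\sum_{j=1}^d (j-1)!\,\frac{u_{l,j}}{(\zeta-\chi_l)^j},\qquad [\mathcal K_{\alpha}f](\boldsymbol u)=\frac1{2\pi i}\oint_{\mathcal C}f(\zeta)\,\exp\Big[\sum_{l=1}^L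 F_l(\boldsymbol u,\zeta)\Big]\frac{\zeta^{P-\alpha}}{\prod_{l=1}^L(\zeta-\chi_l)^{P_l}}\,d\zeta ,$$ where the contour $\mathcal C$ consists of counter-clockwise circles around the points $\chi_l$ that bound pairwise disjoint closed discs; the circles are small enough that, with $K$ the union of these discs, every $B_b$ is analytic on $K$ and $A$ is analytic on $K\times K$. (All sufficiently small circles have this property.) For functions of two variables, $\mathcal K_\alpha\otimes\mathcal K_\gamma$ applies the two transforms in the respective variables. Let $D_{\vec u_l,k}$, $0\le k\le d$, be the constant-coefficient differential operator in $\partial_{u_{l,1}},\dots,\partial_{u_{l,k}}$ determined by $D_{\vec u_l,0}=1$ and the recurrence, for operators evaluated at $\vec u_l=0$, $$D_{\vec u_l,k}\big|_{\vec u_l=0}=D_{\vec u_l,k-1}\Big[\partial_{u_{l,1}}+\sum_{j=1}^{k-1}u_{l,j}\,\partial_{u_{l,j+1}}\Big]\Big|_{\vec u_l=0}\qquad(1\le k\le d),$$ so that $D_{\vec u_l,1}=\partial_{u_{l,1}}$ and $D_{\vec u_l,2}=\partial_{u_{l,1}}^2+\partial_{u_{l,2}}$. Then, as $\vec x\to(\chi_{\psi(1)},\dots,\chi_{\psi(P)})$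 through points with pairwise distinct coordinates and as $\boldsymbol u\to0$, the following two limits exist and are equal: $$\lim_{\vec x\to\vec\chi}\Big(\prod_{i=1}^P\partial_{x_i}^{n_i}\Big)\frac1{\Delta_P(\vec x)}\,\mathrm{Pf}\begin{bmatrix}A(x_a,x_c)&B_{e}(x_a)\\-B_b(x_c)&C_{be}\end{bmatrix}_{\substack{a,c=1,\dots,P\\ b,e=1,\dots,Q}}$$ $$=\lim_{\boldsymbol u\to0}\Big(\prod_{l=1}^L\prod_{k=1}^dD_{\vec u_l,k}^{m_{l,k}}\Big)\mathrm{Pf}\begin{bmatrix}[\mathcal K_\alpha\otimes\mathcal K_\gamma A](\boldsymbol u,\boldsymbol u)&[\mathcal K_\alpha B_{e}](\boldsymbol u)\\-[\mathcal K_\gamma B_b](\boldsymbol u)&C_{be}\end{bmatrix}_{\substack{\alpha,\gamma=1,\dots,P\\ b,e=1,\dots,Q}} .$$ Both differentiated functions are analytic where needed: the ratio on the left at all $\vec x$ with pairwise distinct coordinates close to the limit point, and the Pfaffian on the right at every $\boldsymbol u$. -/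

import Mathlib

open Filter Topology

noncomputable section

namespace PfDeriv

/-- The Pfaffian of a `2N × 2N` matrix,
`Pf M = 1 / (2 ^ N * N!) * ∑_σ sgn σ ∏_i M (σ (2 i)) (σ (2 i + 1))`. -/
def pfaffian {N : ℕ} (M : Matrix (Fin (2 * N)) (Fin (2 * N)) ℂ) : ℂ :=
  (1 / ((2 : ℂ) ^ N * (N.factorial : ℂ))) *
    ∑ σ : Equiv.Perm (Fin (2 * N)), ((Equiv.Perm.sign σ : ℤ) : ℂ) *
      ∏ i : Fin N, M (σ ⟨2 * (i : ℕ), by have := i.2; omega⟩)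
        (σ ⟨2 * (i : ℕ) + 1, by have := i.2; omega⟩)

/-- The bordered matrix `[[a, b], [-bᵀ, c]]` of size `P + Q = 2 N`, rows and columns of the
first block coming first. -/
def bordered {P Q N : ℕ} (h : P + Q = 2 * N) (a : Matrix (Fin P) (Fin P) ℂ)
    (b : Matrix (Fin P) (Fin Q) ℂ) (c : Matrix (Fin Q) (Fin Q) ℂ) :
    Matrix (Fin (2 * N)) (Fin (2 * N)) ℂ :=
  Matrix.reindex (finSumFinEquiv.trans (finCongr h)) (finSumFinEquiv.trans (finCongr h))
    (Matrix.fromBlocks a b (-b.transpose) c)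

/-- The Vandermonde determinant `∏_{k < j} (x_j - x_k) = det [x_j ^ (k - 1)]`. -/
def vandermondeDet {P : ℕ} (x : Fin P → ℂ) : ℂ := (Matrix.vandermonde x).det

/-- The ratio `Pf [[A(x_a, x_c), B_d(x_a)], [-B_b(x_c), C_bd]] / Δ_P(x)`. -/
def pfaffianRatio {P Q N : ℕ} (h : P + Q = 2 * N) (A : ℂ → ℂ → ℂ) (B : Fin Q → ℂ → ℂ)
    (C : Matrix (Fin Q) (Fin Q) ℂ) (x : Fin P → ℂ) : ℂ :=
  (1 / vandermondeDet x) *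
    pfaffian (bordered h (Matrix.of fun a c => A (x a) (x c)) (Matrix.of fun a d => B d (x a)) C)

/-- The complex partial derivative `∂ f / ∂ x_i`, as an operator on functions. -/
def partialDeriv {σ : Type*} [DecidableEq σ] (i : σ) (f : (σ → ℂ) → ℂ) : (σ → ℂ) → ℂ :=
  fun x => deriv (fun t => f (Function.update x i t)) (x i)

/-- The composition `T_0 ∘ T_1 ∘ ⋯ ∘ T_{n-1}` of a finite family of operators. -/
def compAll {X : Type*} {n : ℕ} (T : Fin n → X → X) : X → X :=
  (List.ofFn T).foldr (fun S R => S ∘ R) id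

/-- The polynomial with `D_{u,k} = derivSymbol d k (∂_{u_1}, …, ∂_{u_d})`, for `k ≤ d`; the
variable of index `j` stands for `∂_{u_{j+1}}`. It is given by `D_{u,0} = 1` and the recurrence
`D_{u,k+1} = D_{u,k} [∂_{u_1} + ∑_l u_l ∂_{u_{l+1}}]` at `u = 0`, in which moving `u_l` to the
left through the constant coefficient operator `D_{u,k}` produces the derivative of its symbol
in the `l`-th variable. -/
def derivSymbol (d : ℕ) : ℕ → MvPolynomial (Fin d) ℂ
  | 0 => 1
  | k + 1 => ∑ i : Fin d, MvPolynomial.X i *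
      (match i with
        | ⟨0, _⟩ => derivSymbol d k
        | ⟨j + 1, hj⟩ => MvPolynomial.pderiv ⟨j, Nat.lt_of_succ_lt hj⟩ (derivSymbol d k))

/-- The operator `p (∂_{u_{l,1}}, …, ∂_{u_{l,d}})` acting on functions of `u = (u_{l,j})`. -/
def polyDiffOp {L d : ℕ} (l : Fin L) (p : MvPolynomial (Fin d) ℂ)
    (f : (Fin L × Fin d → ℂ) → ℂ) : (Fin L × Fin d → ℂ) → ℂ :=
  fun u => ∑ s ∈ p.support,
    p.coeff s * compAll (fun j : Fin d => (partialDeriv (l, j))^[s j]) f u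

/-- The differential operator `D_{u_l, k}`. -/
def derivOp {L d : ℕ} (l : Fin L) (k : ℕ) (f : (Fin L × Fin d → ℂ) → ℂ) :
    (Fin L × Fin d → ℂ) → ℂ :=
  polyDiffOp l (derivSymbol d k) f

/-- The multiplicity `m_{l,k}`: the number of variables tending to the `l`-th point that are
differentiated exactly `k` times. -/
def mult {P L : ℕ} (ψ : Fin P → Fin L) (n : Fin P → ℕ) (l : Fin L) (k : ℕ) : ℕ :=
  (Finset.univ.filter fun i => ψ i = l ∧ n i = k).card

/-- `P_l`, the number of variables tending to the `l`-th point. -/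
def fiberCard {P L : ℕ} (ψ : Fin P → Fin L) (l : Fin L) : ℕ :=
  (Finset.univ.filter fun i => ψ i = l).card

/-- `F_d(u_l, χ_l, ζ) = ∑_{j=1}^d (j-1)! u_{l,j} / (ζ - χ_l)^j`. -/
def expFun {L d : ℕ} (χ : Fin L → ℂ) (u : Fin L × Fin d → ℂ) (l : Fin L) (ζ : ℂ) : ℂ :=
  ∑ j : Fin d, ((j : ℕ).factorial : ℂ) * u (l, j) / (ζ - χ l) ^ ((j : ℕ) + 1)

/-- The integral transform `[K_{χ,α} f](u)`; the contour consists of the circles around `χ_l` of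
radius `r_l`. The index `α : Fin P` counts from `0`, so it is `α + 1` in the usual numbering from
`1` to `P` and the exponent of `ζ` is `P - (α + 1) ≥ 0`. -/
def transform {P L d : ℕ} (ψ : Fin P → Fin L) (χ : Fin L → ℂ) (r : Fin L → ℝ) (α : Fin P)
    (f : ℂ → ℂ) (u : Fin L × Fin d → ℂ) : ℂ :=
  (1 / (2 * (Real.pi : ℂ) * Complex.I)) * ∑ l' : Fin L, ∮ ζ in C(χ l', r l'),
    f ζ * Complex.exp (∑ l : Fin L, expFun χ u l ζ) *
      (ζ ^ (P - ((α : ℕ) + 1)) / ∏ l : Fin L, (ζ - χ l) ^ fiberCard ψ l)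

/-- `[K_{χ,α} ⊗ K_{χ,γ} A](u, v)`: the transforms are applied in each entry separately. -/
def transformTensor {P L d : ℕ} (ψ : Fin P → Fin L) (χ : Fin L → ℂ) (r : Fin L → ℝ)
    (α γ : Fin P) (A : ℂ → ℂ → ℂ) (u v : Fin L × Fin d → ℂ) : ℂ :=
  transform ψ χ r α (fun ζ => transform ψ χ r γ (fun ω => A ζ ω) v) u

/-- The Pfaffian of the transformed matrix, as a function of `u`. -/
def transformedPfaffian {P Q N L d : ℕ} (h : P + Q = 2 * N) (ψ : Fin P → Fin L)
    (χ : Fin L → ℂ) (r : Fin L → ℝ) (A : ℂ → ℂ → ℂ) (B : Fin Q → ℂ → ℂ)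
    (C : Matrix (Fin Q) (Fin Q) ℂ) (u : Fin L × Fin d → ℂ) : ℂ :=
  pfaffian (bordered h (Matrix.of fun α γ => transformTensor ψ χ r α γ A u u)
    (Matrix.of fun α b => transform ψ χ r α (B b) u) C)

/-- The union of the closed discs bounded by the circles of the contour. -/
def discs {L : ℕ} (χ : Fin L → ℂ) (r : Fin L → ℝ) : Set ℂ :=
  ⋃ l : Fin L, Metric.closedBall (χ l) (r l)

/-- The circles of radius `r_l` around `χ_l` are close enough to the points `χ_l`: they bound
pairwise disjoint closed discs, on which the functions `A` and `B_b` are analytic. -/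
structure IsAdmissible {Q L : ℕ} (χ : Fin L → ℂ) (A : ℂ → ℂ → ℂ) (B : Fin Q → ℂ → ℂ)
    (r : Fin L → ℝ) : Prop where
  pos : ∀ l, 0 < r l
  disjoint : ∀ l l', l ≠ l' →
    Disjoint (Metric.closedBall (χ l) (r l)) (Metric.closedBall (χ l') (r l'))
  analytic_A : AnalyticOnNhd ℂ (fun p : ℂ × ℂ => A p.1 p.2) (discs χ r ×ˢ discs χ r)
  analytic_B : ∀ b, AnalyticOnNhd ℂ (B b) (discs χ r)

end PfDeriv

end

namespace PfDeriv

open scoped ContDiff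

/-! Both sides come from a single entire function Φ on the Banach algebra `C(circles χ r, ℂ)`: Φ(w)
is the Pfaffian of contour transforms taken with a weight w (`IsAdmissible.weightFun`), and it is a
polynomial in w. The right-hand Pfaffian is Φ(w₀ exp ∑ F_l) with w₀ = ∏ (z - χ_l)^(-P_l)
(`transformedPfaffian_eq`). On the left, 1/Δ is the determinant of `residueMatrix`; absorbing it by
congruence and reading the new entries as sums of residues gives Φ(w_x) with w_x = ∏ (z - x_i)⁻¹
(`pfaffianRatio_eq`). This expression is analytic also where coordinates coincide.

It remains to compare derivatives. Moving x_i from χ_l to χ_l + t divides the weight by 1 - t a,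
with a = 1/(z - χ_l). Modulo t^(d+1), 1/(1 - t a) is exp(∑_{j ≤ d} t^j a^j / j), which is the effect
of adding t^j / j! to each u_{l,j}; so derivatives of order at most d agree
(`iteratedDeriv_comp_eq_jetOp`). The recurrence for D_{u_l,k} is the chain rule along the curve (t,
t²/2!, t³/3!, …), so D_{u_l,k} is the k-th derivative along this curve, started at any u
(`symbolOp_blockSymbol_eq_iteratedDeriv`).

Each differentiation, on either side, therefore replaces Φ by the same entire function `jetOp` of
the weight, and the comparison can be iterated over all variables (`partialList_comp_eq_jetList`,
`symbolOp_prod_entireComp`). Since w_x and w₀ exp ∑ F_l both equal w₀ at the limit points, the two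
limits are `IsAdmissible.limitValue`. -/

/-! ### Pfaffians under congruence -/

theorem prod_univ_two_mul {M : Type*} [CommMonoid M] {N : ℕ} (g : Fin (2 * N) → M) :
    ∏ j, g j = ∏ i : Fin N, (g ⟨2 * (i : ℕ), by have := i.2; omega⟩ *
      g ⟨2 * (i : ℕ) + 1, by have := i.2; omega⟩) := by
  induction N with
  | zero => simp
  | succ N ih =>
    have h1 : ∏ j : Fin (2 * (N + 1)), g j = ∏ j : Fin (2 * N + 1 + 1), g j := rfl
    rw [h1, Fin.prod_univ_castSucc, Fin.prod_univ_castSucc, Fin.prod_univ_castSucc,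
      ih (fun j => g j.castSucc.castSucc), mul_assoc]
    rfl

theorem sum_function_eq_sum_perm {n : ℕ} (F : (Fin n → Fin n) → ℂ)
    (hF : ∀ f, ¬ Function.Injective f → F f = 0) :
    ∑ f, F f = ∑ τ : Equiv.Perm (Fin n), F τ := by
  symm
  refine Finset.sum_of_injOn (fun τ : Equiv.Perm (Fin n) => (τ : Fin n → Fin n)) ?_ ?_ ?_ ?_
  · exact fun a _ b _ h => DFunLike.coe_injective h
  · simp
  · intro f _ hf
    apply hF
    intro hinj
    exact hf ⟨Equiv.ofBijective f (Finite.injective_iff_bijective.mp hinj), by simp, by ext; simp⟩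
  · simp

/-- Functions on `Fin (2 * N)` correspond to `N` pairs of values. -/
def pairsEquiv (N : ℕ) (X : Type*) : (Fin (2 * N) → X) ≃ (Fin N → X × X) where
  toFun f i := (f ⟨2 * (i : ℕ), by have := i.2; omega⟩, f ⟨2 * (i : ℕ) + 1, by have := i.2; omega⟩)
  invFun p j := if (j : ℕ) % 2 = 0 then (p ⟨(j : ℕ) / 2, by have := j.2; omega⟩).1
    else (p ⟨(j : ℕ) / 2, by have := j.2; omega⟩).2
  left_inv f := by
    ext j
    by_cases h : (j : ℕ) % 2 = 0
    · simp only [h, if_true]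
      congr 1
      ext
      simp only
      omega
    · simp only [h, if_false]
      congr 1
      ext
      simp only
      omega
  right_inv p := by
    ext i
    · simp
    · have h : (2 * (i : ℕ) + 1) / 2 = i := by omega
      simp [h, Nat.add_mod]

/-- Expanding every entry turns the Pfaffian into a sum over maps f choosing columns of W. For fixed
f the sum over permutations is the determinant of those columns: it vanishes when f repeats a
column, and otherwise it is a sign times det W. -/
theorem pfaffian_conj {N : ℕ} (W M : Matrix (Fin (2 * N)) (Fin (2 * N)) ℂ) :
    pfaffian (W * M * W.transpose) = W.det * pfaffian M := by
  unfold pfaffian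
  rw [mul_left_comm]
  congr 1
  have hentry : ∀ a b, (W * M * W.transpose) a b =
      ∑ q : Fin (2 * N) × Fin (2 * N), W a q.1 * W b q.2 * M q.1 q.2 := by
    intro a b
    rw [Fintype.sum_prod_type, Finset.sum_comm]
    simp only [Matrix.mul_apply, Matrix.transpose_apply, Finset.sum_mul]
    exact Finset.sum_congr rfl fun _ _ => Finset.sum_congr rfl fun _ _ => by ring
  simp only [hentry, Finset.prod_univ_sum, Fintype.piFinset_univ, Finset.mul_sum]
  -- The N pairs of summation indices are merged into one map on `Fin (2 * N)`.
  rw [Finset.sum_comm, ← (pairsEquiv N (Fin (2 * N))).sum_comp]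
  have hterm : ∀ f : Fin (2 * N) → Fin (2 * N),
      (∑ σ : Equiv.Perm (Fin (2 * N)), ((Equiv.Perm.sign σ : ℤ) : ℂ) * ∏ i : Fin N,
        (W (σ ⟨2 * (i : ℕ), by have := i.2; omega⟩) (pairsEquiv N _ f i).1 *
          W (σ ⟨2 * (i : ℕ) + 1, by have := i.2; omega⟩) (pairsEquiv N _ f i).2 *
          M (pairsEquiv N _ f i).1 (pairsEquiv N _ f i).2)) =
      (W.submatrix id f).det * ∏ i : Fin N, M (f ⟨2 * (i : ℕ), by have := i.2; omega⟩)
        (f ⟨2 * (i : ℕ) + 1, by have := i.2; omega⟩) := by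
    intro f
    rw [Matrix.det_apply', Finset.sum_mul]
    refine Finset.sum_congr rfl fun σ _ => ?_
    rw [prod_univ_two_mul, Finset.prod_mul_distrib, mul_assoc]
    rfl
  rw [Finset.sum_congr rfl fun f _ => hterm f, sum_function_eq_sum_perm]
  · refine Finset.sum_congr rfl fun τ _ => ?_
    rw [Matrix.det_permute']
    ring
  · intro f hf
    rw [Function.Injective] at hf
    push Not at hf
    obtain ⟨a, b, hab, hne⟩ := hf
    rw [Matrix.det_zero_of_column_eq hne (by simp [hab]), zero_mul]

/-- This is congruence by the block matrix diag(W, 1). -/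
theorem pfaffian_bordered_conj {P Q N : ℕ} (h : P + Q = 2 * N) (W a : Matrix (Fin P) (Fin P) ℂ)
    (b : Matrix (Fin P) (Fin Q) ℂ) (c : Matrix (Fin Q) (Fin Q) ℂ) :
    pfaffian (bordered h (W * a * W.transpose) (W * b) c) = W.det * pfaffian (bordered h a b c) := by
  have hb : ∀ a b c, bordered h a b c = (Matrix.fromBlocks a b (-b.transpose) c).submatrix
      (finSumFinEquiv.trans (finCongr h)).symm (finSumFinEquiv.trans (finCongr h)).symm :=
    fun _ _ _ => rfl
  rw [hb, hb]
  generalize (finSumFinEquiv.trans (finCongr h)).symm = e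
  have hdet : ((Matrix.fromBlocks W 0 0 (1 : Matrix (Fin Q) (Fin Q) ℂ)).submatrix e e).det =
      W.det := by
    simp
  rw [← hdet, ← pfaffian_conj, Matrix.transpose_submatrix, Matrix.submatrix_mul_equiv,
    Matrix.submatrix_mul_equiv, Matrix.fromBlocks_transpose, Matrix.fromBlocks_multiply,
    Matrix.fromBlocks_multiply]
  simp [Matrix.transpose_mul]

/-! ### The residue matrix -/

/-- The matrix of the contour transforms with the denominator `∏ (ζ - x_i)`, by residues. -/
noncomputable def residueMatrix {P : ℕ} (x : Fin P → ℂ) : Matrix (Fin P) (Fin P) ℂ :=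
  Matrix.of fun α i => x i ^ (P - ((α : ℕ) + 1)) * ∏ j ∈ Finset.univ.erase i, (x i - x j)⁻¹

/-- With the column factors pulled out, the powers form a Vandermonde matrix in reversed order, with
determinant ∏_{i<j} (x_i - x_j). The column factors run over ordered pairs i ≠ j; half of them
cancel this determinant and the other half is 1/Δ. -/
theorem det_residueMatrix {P : ℕ} {x : Fin P → ℂ} (hx : Function.Injective x) :
    (residueMatrix x).det = 1 / vandermondeDet x := by
  have h1 : (residueMatrix x).det =
      (Matrix.projVandermonde 1 x).det * ∏ i, ∏ j ∈ Finset.univ.erase i, (x i - x j)⁻¹ := by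
    rw [← Matrix.det_transpose, mul_comm,
      ← Matrix.det_mul_column (fun i => ∏ j ∈ Finset.univ.erase i, (x i - x j)⁻¹)]
    congr 1
    ext i α
    simp [residueMatrix, Matrix.projVandermonde_apply, Fin.val_rev, mul_comm]
  have h2 : ∏ i, ∏ j ∈ Finset.univ.erase i, (x i - x j)⁻¹ =
      (∏ i, ∏ j ∈ Finset.Ioi i, (x i - x j)⁻¹) * ∏ i, ∏ j ∈ Finset.Ioi i, (x j - x i)⁻¹ := by
    have h3 : ∏ i, ∏ j ∈ Finset.Ioi i, (x j - x i)⁻¹ = ∏ j, ∏ i ∈ Finset.Iio j, (x j - x i)⁻¹ := by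
      apply Finset.prod_comm'
      simp
    rw [h3, ← Finset.prod_mul_distrib]
    refine Finset.prod_congr rfl fun i _ => ?_
    rw [← Finset.prod_union]
    · congr 1
      ext j
      simp only [Finset.mem_erase, Finset.mem_union, Finset.mem_Ioi, Finset.mem_Iio,
        Finset.mem_univ, and_true]
      exact ⟨fun hj => (lt_or_gt_of_ne hj).symm, fun hj => hj.elim ne_of_gt ne_of_lt⟩
    · rw [Finset.disjoint_left]
      intro j hj hj'
      exact absurd (Finset.mem_Ioi.mp hj) (not_lt_of_gt (Finset.mem_Iio.mp hj'))
  rw [h1, h2, Matrix.det_projVandermonde, vandermondeDet, Matrix.det_vandermonde, ← mul_assoc,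
    ← Finset.prod_mul_distrib]
  have h4 : ∏ i : Fin P, ((∏ j ∈ Finset.Ioi i, ((1 : Fin P → ℂ) j * x i - (1 : Fin P → ℂ) i * x j)) *
      ∏ j ∈ Finset.Ioi i, (x i - x j)⁻¹) = 1 := by
    refine Finset.prod_eq_one fun i _ => ?_
    rw [← Finset.prod_mul_distrib]
    refine Finset.prod_eq_one fun j hj => ?_
    have : x i - x j ≠ 0 := sub_ne_zero.mpr fun h => (Finset.mem_Ioi.mp hj).ne (hx h)
    simp [this]
  rw [h4]
  simp

/-! ### Contour integrals as bounded functionals of the weight -/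

/-- The union of the circles of radius `|r l|` around `χ l`. -/
def circles {L : ℕ} (χ : Fin L → ℂ) (r : Fin L → ℝ) : Set ℂ := ⋃ l, Metric.sphere (χ l) |r l|

instance {L : ℕ} (χ : Fin L → ℂ) (r : Fin L → ℝ) : CompactSpace (circles χ r) :=
  isCompact_iff_compactSpace.mp (isCompact_iUnion fun _ => isCompact_sphere _ _)

theorem circles_subset_discs {L : ℕ} {χ : Fin L → ℂ} {r : Fin L → ℝ} (hr : ∀ l, 0 < r l) :
    circles χ r ⊆ discs χ r := by
  refine Set.iUnion_mono fun l => ?_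
  rw [abs_of_pos (hr l)]
  exact Metric.sphere_subset_closedBall

/-- The parametrization of the circle around `χ l` as a map into the union of the circles. -/
noncomputable def circlePath {L : ℕ} (χ : Fin L → ℂ) (r : Fin L → ℝ) (l : Fin L) : C(ℝ, circles χ r) where
  toFun θ := ⟨circleMap (χ l) (r l) θ, Set.mem_iUnion.mpr ⟨l, circleMap_mem_sphere' _ _ _⟩⟩
  continuous_toFun := (continuous_circleMap _ _).subtype_mk _

/-- Contour integration over the union of the circles, as a functional on continuous functions. -/
noncomputable def contourCLM {L : ℕ} (χ : Fin L → ℂ) (r : Fin L → ℝ) :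
    C(circles χ r, ℂ) →L[ℂ] ℂ :=
  ∑ l, LinearMap.mkContinuous
    { toFun := fun g => ∫ θ in (0 : ℝ)..2 * Real.pi,
        deriv (circleMap (χ l) (r l)) θ • g (circlePath χ r l θ)
      map_add' := fun f g => by
        rw [← intervalIntegral.integral_add]
        · simp [mul_add]
        · apply Continuous.intervalIntegrable
          simp only [deriv_circleMap]
          fun_prop
        · apply Continuous.intervalIntegrable
          simp only [deriv_circleMap]
          fun_prop
      map_smul' := fun c g => by
        rw [RingHom.id_apply, ← intervalIntegral.integral_smul]
        simp [mul_left_comm] } (|r l| * |2 * Real.pi - 0|) fun g => by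
      refine (intervalIntegral.norm_integral_le_of_norm_le_const (C := |r l| * ‖g‖)
        fun θ _ => ?_).trans (le_of_eq (by ring))
      rw [norm_smul]
      refine mul_le_mul (le_of_eq ?_) (g.norm_coe_le_norm _) (norm_nonneg _) (abs_nonneg _)
      simp [deriv_circleMap]

theorem contourCLM_apply {L : ℕ} {χ : Fin L → ℂ} {r : Fin L → ℝ} (g : C(circles χ r, ℂ))
    (f : ℂ → ℂ) (hf : ∀ z : circles χ r, f z = g z) : contourCLM χ r g = ∑ l, ∮ z in C(χ l, r l), f z := by
  simp only [contourCLM, sum_apply, LinearMap.mkContinuous_apply,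
    LinearMap.coe_mk, AddHom.coe_mk, circleIntegral]
  refine Finset.sum_congr rfl fun l _ => ?_
  congr 1
  ext θ
  rw [← hf]
  rfl

/-- `g ↦ (1 / 2πi) ∮ z ^ k g(z) dz`. -/
noncomputable def momentCLM {L : ℕ} (χ : Fin L → ℂ) (r : Fin L → ℝ) (k : ℕ) :
    C(circles χ r, ℂ) →L[ℂ] ℂ :=
  (1 / (2 * (Real.pi : ℂ) * Complex.I)) • (contourCLM χ r).comp
    (ContinuousLinearMap.mul ℂ _ (⟨fun z => (z : ℂ) ^ k, by fun_prop⟩ : C(circles χ r, ℂ)))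

theorem momentCLM_apply {L : ℕ} {χ : Fin L → ℂ} {r : Fin L → ℝ} (k : ℕ) (g : C(circles χ r, ℂ))
    (f : ℂ → ℂ) (hf : ∀ z : circles χ r, f z = (z : ℂ) ^ k * g z) : momentCLM χ r k g =
      (1 / (2 * (Real.pi : ℂ) * Complex.I)) * ∑ l, ∮ z in C(χ l, r l), f z := by
  rw [← contourCLM_apply (⟨fun z => (z : ℂ) ^ k, by fun_prop⟩ * g) f hf]
  rfl

/-- The integral operator `w ↦ (z ↦ T (a(z, ·) w))` with a continuous kernel `a`. -/
noncomputable def kernelCLM {S : Type*} [TopologicalSpace S] [CompactSpace S]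
    (T : C(S, ℂ) →L[ℂ] ℂ) (a : C(S, C(S, ℂ))) : C(S, ℂ) →L[ℂ] C(S, ℂ) :=
  LinearMap.mkContinuous
    { toFun := fun w => ⟨fun z => T (a z * w), by fun_prop⟩
      map_add' := fun f g => by ext z; simp [mul_add]
      map_smul' := fun c g => by ext z; simp } (‖T‖ * ‖a‖) fun w => by
    refine (ContinuousMap.norm_le _ (by positivity)).mpr fun z => ?_
    refine (T.le_opNorm _).trans ?_
    rw [mul_assoc]
    gcongr
    exact (norm_mul_le _ _).trans (by gcongr; exact a.norm_coe_le_norm z)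

theorem kernelCLM_apply {S : Type*} [TopologicalSpace S] [CompactSpace S]
    (T : C(S, ℂ) →L[ℂ] ℂ) (a : C(S, C(S, ℂ))) (w : C(S, ℂ)) (z : S) :
    kernelCLM T a w z = T (a z * w) := rfl

/-- The Pfaffian with entries `T_α (w · K_γ w)` and `T_α (b_e w)`, where `K_γ` is the integral
operator with kernel `a` built on `T_γ`. -/
noncomputable def weightPfaffian {P Q N : ℕ} (h : P + Q = 2 * N) {S : Type*} [TopologicalSpace S]
    [CompactSpace S] (T : Fin P → C(S, ℂ) →L[ℂ] ℂ) (a : C(S, C(S, ℂ))) (b : Fin Q → C(S, ℂ))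
    (C : Matrix (Fin Q) (Fin Q) ℂ) (w : C(S, ℂ)) : ℂ :=
  pfaffian (bordered h (Matrix.of fun α γ => T α (w * kernelCLM (T γ) a w))
    (Matrix.of fun α e => T α (b e * w)) C)

theorem contDiff_pfaffian_bordered {P Q N : ℕ} (h : P + Q = 2 * N) {E : Type*}
    [NormedAddCommGroup E] [NormedSpace ℂ E] {n : WithTop ℕ∞} {a : E → Matrix (Fin P) (Fin P) ℂ}
    {b : E → Matrix (Fin P) (Fin Q) ℂ} (C : Matrix (Fin Q) (Fin Q) ℂ)
    (ha : ∀ i j, ContDiff ℂ n fun w => a w i j) (hb : ∀ i j, ContDiff ℂ n fun w => b w i j) :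
    ContDiff ℂ n fun w => pfaffian (bordered h (a w) (b w) C) := by
  have key : ∀ i j, ContDiff ℂ n fun w => bordered h (a w) (b w) C i j := by
    intro i j
    simp only [bordered, Matrix.reindex_apply, Matrix.submatrix_apply]
    generalize (finSumFinEquiv.trans (finCongr h)).symm i = i
    generalize (finSumFinEquiv.trans (finCongr h)).symm j = j
    rcases i with i | i <;> rcases j with j | j
    · exact ha i j
    · exact hb i j
    · exact (hb j i).neg
    · exact contDiff_const
  unfold pfaffian
  exact contDiff_const.mul (ContDiff.sum fun σ _ => contDiff_const.mul
    (contDiff_prod fun i _ => key _ _))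

/-- The entries are constant, linear or quadratic in w with bounded coefficients, so the Pfaffian is
a continuous polynomial in w. -/
theorem contDiff_weightPfaffian {P Q N : ℕ} (h : P + Q = 2 * N) {S : Type*} [TopologicalSpace S]
    [CompactSpace S] (T : Fin P → C(S, ℂ) →L[ℂ] ℂ) (a : C(S, C(S, ℂ))) (b : Fin Q → C(S, ℂ))
    (C : Matrix (Fin Q) (Fin Q) ℂ) {n : WithTop ℕ∞} : ContDiff ℂ n (weightPfaffian h T a b C) := by
  unfold weightPfaffian
  refine contDiff_pfaffian_bordered h C (fun α γ => ?_) fun α e => ?_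
  · exact (T α).contDiff.comp (contDiff_id.mul (kernelCLM (T γ) a).contDiff)
  · exact (T α).contDiff.comp (contDiff_const.mul contDiff_id)

/-! ### Residues at distinct simple poles -/

/-- Partial fractions, obtained from Lagrange interpolation of the constant 1. For P = 0 the product
is 1 and the sum is 0, hence `NeZero P`. -/
theorem prod_inv_sub_eq_sum {P : ℕ} [NeZero P] {x : Fin P → ℂ} (hx : Function.Injective x) {z : ℂ}
    (hz : ∀ i, z ≠ x i) : ∏ i, (z - x i)⁻¹ =
      ∑ i, (∏ j ∈ Finset.univ.erase i, (x i - x j)⁻¹) * (z - x i)⁻¹ := by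
  have h := Lagrange.eval_interpolate_not_at_node (s := Finset.univ) (v := x) 1
    (fun i _ => hz i)
  rw [Lagrange.interpolate_one hx.injOn Finset.univ_nonempty, Lagrange.eval_nodal] at h
  simp only [Polynomial.eval_one, Pi.one_apply, mul_one] at h
  rw [Finset.prod_inv_distrib]
  exact inv_eq_of_mul_eq_one_right h.symm

/-- Cauchy's formula applies in the disc that contains x; the integrand is holomorphic on the other
discs. -/
theorem contourIntegral_inv_sub {L : ℕ} {χ : Fin L → ℂ} {r : Fin L → ℝ} (hr : ∀ l, 0 < r l)
    (hdisj : ∀ l l', l ≠ l' →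
      Disjoint (Metric.closedBall (χ l) (r l)) (Metric.closedBall (χ l') (r l')))
    {f : ℂ → ℂ} (hf : DifferentiableOn ℂ f (discs χ r)) {l₀ : Fin L} {x : ℂ}
    (hx : x ∈ Metric.ball (χ l₀) (r l₀)) :
    ∑ l, (∮ z in C(χ l, r l), (z - x)⁻¹ * f z) = 2 * (Real.pi : ℂ) * Complex.I * f x := by
  have hfl : ∀ l, DifferentiableOn ℂ f (Metric.closedBall (χ l) (r l)) := fun l =>
    hf.mono (Set.subset_iUnion (fun l => Metric.closedBall (χ l) (r l)) l)
  rw [Finset.sum_eq_single l₀]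
  · exact (hfl l₀).circleIntegral_sub_inv_smul hx
  · intro l _ hl
    refine DiffContOnCl.circleIntegral_eq_zero (hr l).le (DifferentiableOn.diffContOnCl ?_)
    rw [closure_ball _ (hr l).ne']
    refine DifferentiableOn.mul (DifferentiableOn.inv (by fun_prop) fun z hz => ?_) (hfl l)
    rintro h0
    rw [sub_eq_zero] at h0
    exact (Set.disjoint_left.mp (hdisj l l₀ hl)) hz (h0 ▸ Metric.ball_subset_closedBall hx)
  · simp

theorem contourIntegral_prod_inv_sub {L P : ℕ} [NeZero P] {χ : Fin L → ℂ} {r : Fin L → ℝ}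
    (hr : ∀ l, 0 < r l) (hdisj : ∀ l l', l ≠ l' →
      Disjoint (Metric.closedBall (χ l) (r l)) (Metric.closedBall (χ l') (r l')))
    {f : ℂ → ℂ} (hf : DifferentiableOn ℂ f (discs χ r)) (φ : Fin P → Fin L) {x : Fin P → ℂ}
    (hinj : Function.Injective x) (hx : ∀ i, x i ∈ Metric.ball (χ (φ i)) (r (φ i))) :
    (1 / (2 * (Real.pi : ℂ) * Complex.I)) *
      ∑ l, (∮ z in C(χ l, r l), f z * ∏ i, (z - x i)⁻¹) =
      ∑ i, (∏ j ∈ Finset.univ.erase i, (x i - x j)⁻¹) * f (x i) := by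
  have hne : ∀ i l, ∀ z ∈ Metric.sphere (χ l) (r l), z ≠ x i := by
    rintro i l z hz rfl
    by_cases h : l = φ i
    · subst h
      exact (Metric.mem_ball.mp (hx i)).ne hz
    · exact Set.disjoint_left.mp (hdisj l _ h) (Metric.sphere_subset_closedBall hz)
        (Metric.ball_subset_closedBall (hx i))
  have hcont : ∀ l, ContinuousOn f (Metric.sphere (χ l) (r l)) := fun l =>
    (hf.mono (Metric.sphere_subset_closedBall.trans
      (Set.subset_iUnion (fun l => Metric.closedBall (χ l) (r l)) l))).continuousOn
  have h1 : ∀ l, (∮ z in C(χ l, r l), f z * ∏ i, (z - x i)⁻¹) =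
      ∑ i, (∏ j ∈ Finset.univ.erase i, (x i - x j)⁻¹) *
        ∮ z in C(χ l, r l), (z - x i)⁻¹ * f z := by
    intro l
    rw [circleIntegral.integral_congr (hr l).le (g := fun z => ∑ i,
      (∏ j ∈ Finset.univ.erase i, (x i - x j)⁻¹) • ((z - x i)⁻¹ * f z)), circleIntegral.integral_fun_sum]
    · exact Finset.sum_congr rfl fun i _ => circleIntegral.integral_smul _ _ _ _
    · intro i _
      refine ContinuousOn.circleIntegrable (hr l).le (ContinuousOn.fun_const_smul
        (ContinuousOn.fun_mul (ContinuousOn.inv₀ (by fun_prop)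
          fun z hz => sub_ne_zero.mpr (hne i l z hz)) (hcont l)) _)
    · intro z hz
      simp only [smul_eq_mul]
      rw [prod_inv_sub_eq_sum hinj fun i => hne i l z hz, Finset.mul_sum]
      exact Finset.sum_congr rfl fun i _ => by ring
  simp only [h1]
  rw [Finset.sum_comm, Finset.mul_sum]
  refine Finset.sum_congr rfl fun i _ => ?_
  rw [← Finset.mul_sum, contourIntegral_inv_sub hr hdisj hf (hx i)]
  have := Complex.two_pi_I_ne_zero
  field_simp

/-! ### Constant coefficient operators on entire functions -/

section Operators

variable {σ : Type*} [Fintype σ] [DecidableEq σ]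

theorem partialDeriv_eq_fderiv {i : σ} {f : (σ → ℂ) → ℂ} {x : σ → ℂ}
    (hf : DifferentiableAt ℂ f x) : partialDeriv i f x = fderiv ℂ f x (Pi.single i 1) := by
  have h := HasFDerivAt.comp_hasDerivAt_of_eq (x i) hf.hasFDerivAt
    (hasDerivAt_update x i (x i)) (by simp)
  exact h.deriv

theorem contDiff_partialDeriv {i : σ} {f : (σ → ℂ) → ℂ} (hf : ContDiff ℂ ω f) :
    ContDiff ℂ ω (partialDeriv i f) := by
  have : partialDeriv i f = fun x => fderiv ℂ f x (Pi.single i 1) :=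
    funext fun x => partialDeriv_eq_fderiv (hf.differentiable (by simp) x)
  rw [this]
  exact (hf.fderiv_right (by simp)).clm_apply contDiff_const

theorem partialDeriv_comm (i j : σ) {f : (σ → ℂ) → ℂ} (hf : ContDiff ℂ ω f) :
    partialDeriv i (partialDeriv j f) = partialDeriv j (partialDeriv i f) := by
  have h1 : ∀ i, partialDeriv i f = fun x => fderiv ℂ f x (Pi.single i 1) := fun i =>
    funext fun x => partialDeriv_eq_fderiv (hf.differentiable (by simp) x)
  have h2 : ∀ i j x, partialDeriv i (partialDeriv j f) x =
      fderiv ℂ (fderiv ℂ f) x (Pi.single i 1) (Pi.single j 1) := by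
    intro i j x
    rw [partialDeriv_eq_fderiv ((contDiff_partialDeriv hf).differentiable (by simp) x), h1,
      fderiv_clm_apply (((hf.fderiv_right (m := ω) (by simp)).differentiable (by simp)) x)
        (by fun_prop)]
    simp
  ext x
  rw [h2, h2]
  exact (hf.contDiffAt.isSymmSndFDerivAt_of_omega).eq _ _

variable (σ) in
/-- The space of entire functions of the variables indexed by `σ`. -/
def entire : Submodule ℂ ((σ → ℂ) → ℂ) where
  carrier := {f | ContDiff ℂ ω f}
  add_mem' {f g} (hf : ContDiff ℂ ω f) (hg : ContDiff ℂ ω g) := (hf.add hg : ContDiff ℂ ω (f + g))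
  zero_mem' := (contDiff_const : ContDiff ℂ ω fun _ => (0 : ℂ))
  smul_mem' c f (hf : ContDiff ℂ ω f) := (contDiff_const.smul hf : ContDiff ℂ ω (c • f))

omit [DecidableEq σ] in
theorem contDiff_coe (f : entire σ) : ContDiff ℂ ω (f : (σ → ℂ) → ℂ) := f.2

/-- The partial derivative as an endomorphism of the space of entire functions. -/
noncomputable def partialEnd (i : σ) : Module.End ℂ (entire σ) where
  toFun f := ⟨partialDeriv i f, contDiff_partialDeriv (contDiff_coe f)⟩
  map_add' f g := by
    ext x
    have hf := (contDiff_coe f).differentiable (by simp) x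
    have hg := (contDiff_coe g).differentiable (by simp) x
    change partialDeriv i ((f : (σ → ℂ) → ℂ) + g) x = partialDeriv i f x + partialDeriv i g x
    rw [partialDeriv_eq_fderiv hf, partialDeriv_eq_fderiv hg, partialDeriv_eq_fderiv (hf.add hg),
      fderiv_add hf hg]
    rfl
  map_smul' c f := by
    ext x
    have hf := (contDiff_coe f).differentiable (by simp) x
    change partialDeriv i (c • (f : (σ → ℂ) → ℂ)) x = c • partialDeriv i f x
    rw [partialDeriv_eq_fderiv hf, partialDeriv_eq_fderiv (hf.const_smul c),
      fderiv_const_smul hf]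
    rfl

/-- The algebra generated by the partial derivatives is commutative. -/
instance : IsMulCommutative (Algebra.adjoin ℂ (Set.range (partialEnd (σ := σ)))) :=
  Algebra.isMulCommutative_adjoin ℂ (by
    rintro _ ⟨i, rfl⟩ _ ⟨j, rfl⟩
    ext f : 2
    exact partialDeriv_comm i j (contDiff_coe f))

variable (σ) in
open scoped IsMulCommutative in
/-- The constant coefficient differential operator with a given symbol. -/
noncomputable def symbolOp : MvPolynomial σ ℂ →ₐ[ℂ] Module.End ℂ (entire σ) :=
  (Algebra.adjoin ℂ (Set.range (partialEnd (σ := σ)))).val.comp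
    (MvPolynomial.aeval fun i => ⟨partialEnd i, Algebra.subset_adjoin ⟨i, rfl⟩⟩)

theorem symbolOp_X (i : σ) : symbolOp σ (MvPolynomial.X i) = partialEnd i := by
  simp [symbolOp]

/-- Multiplication by `x_i - c` on entire functions. -/
def mulCoord (i : σ) (c : ℂ) : Module.End ℂ (entire σ) where
  toFun f := ⟨fun x => (x i - c) * (f : (σ → ℂ) → ℂ) x,
    ((contDiff_apply ℂ ℂ i).sub contDiff_const).mul (contDiff_coe f)⟩
  map_add' f g := by ext x; simp [mul_add]
  map_smul' a f := by ext x; simp; ring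

theorem partialEnd_mulCoord (j i : σ) (c : ℂ) (f : entire σ) :
    partialEnd j (mulCoord i c f) =
      mulCoord i c (partialEnd j f) + (Pi.single i 1 : σ → ℂ) j • f := by
  ext x
  have hf := (contDiff_coe f).differentiable (by simp) x
  have hx : DifferentiableAt ℂ (fun x : σ → ℂ => x i - c) x := by fun_prop
  change partialDeriv j (fun x => (x i - c) * (f : (σ → ℂ) → ℂ) x) x =
    (x i - c) * partialDeriv j f x + (Pi.single i 1 : σ → ℂ) j * (f : (σ → ℂ) → ℂ) x
  rw [partialDeriv_eq_fderiv hf, partialDeriv_eq_fderiv (hx.fun_mul hf), fderiv_fun_mul hx hf]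
  have : fderiv ℂ (fun x : σ → ℂ => x i - c) x = ContinuousLinearMap.proj i := by
    rw [fderiv_sub_const]
    exact (ContinuousLinearMap.proj (R := ℂ) (φ := fun _ : σ => ℂ) i).fderiv
  rw [this]
  simp [Pi.single_apply, eq_comm, mul_comm]

/-- The Heisenberg relation: the commutator of p(∂) with multiplication by x_i - c has symbol
∂p/∂X_i. The case of a single derivative is the product rule, and induction on p does the rest. -/
theorem symbolOp_mulCoord (i : σ) (c : ℂ) (p : MvPolynomial σ ℂ) (f : entire σ) :
    symbolOp σ p (mulCoord i c f) =
      mulCoord i c (symbolOp σ p f) + symbolOp σ (MvPolynomial.pderiv i p) f := by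
  induction p using MvPolynomial.induction_on generalizing f with
  | C a => simp [← MvPolynomial.algebraMap_eq, Module.algebraMap_end_apply]
  | add p q hp hq =>
    simp only [map_add, LinearMap.add_apply, hp, hq]
    abel
  | mul_X p j hp =>
    rw [Derivation.leibniz, MvPolynomial.pderiv_X]
    simp only [map_mul, map_add, symbolOp_X, Module.End.mul_apply, partialEnd_mulCoord, hp,
      LinearMap.add_apply, smul_eq_mul]
    have : symbolOp σ ((Pi.single i 1 : σ → MvPolynomial σ ℂ) j) f =
        (Pi.single i 1 : σ → ℂ) j • f := by
      by_cases h : j = i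
      · subst h; simp
      · simp [h]
    rw [this, ← symbolOp_X j, ← Module.End.mul_apply (symbolOp σ (MvPolynomial.X j)), ← map_mul,
      mul_comm (MvPolynomial.X j), map_mul, Module.End.mul_apply, map_smul]
    abel

/-- Centring the multiplication at the evaluation point leaves only the commutator; this is how
`derivSymbol` encodes the recurrence for D. -/
theorem symbolOp_mulCoord_self (i : σ) (u : σ → ℂ) (p : MvPolynomial σ ℂ) (f : entire σ) :
    (symbolOp σ p (mulCoord i (u i) f) : (σ → ℂ) → ℂ) u =
      (symbolOp σ (MvPolynomial.pderiv i p) f : (σ → ℂ) → ℂ) u := by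
  rw [symbolOp_mulCoord]
  change (u i - u i) * _ + _ = _
  simp

/-- `E` is the restriction of the operator `T` to the entire functions. -/
def Restricts (T : ((σ → ℂ) → ℂ) → (σ → ℂ) → ℂ) (E : Module.End ℂ (entire σ)) : Prop :=
  ∀ f : entire σ, T f = E f

omit [DecidableEq σ] in
theorem Restricts.iterate {T : ((σ → ℂ) → ℂ) → (σ → ℂ) → ℂ} {E : Module.End ℂ (entire σ)}
    (h : Restricts T E) (m : ℕ) : Restricts T^[m] (E ^ m) := by
  induction m with
  | zero => intro f; simp
  | succ m ih =>
    intro f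
    rw [Function.iterate_succ_apply', ih, h, pow_succ', Module.End.mul_apply]

theorem compAll_succ {X : Type*} {n : ℕ} (T : Fin (n + 1) → X → X) :
    compAll T = T 0 ∘ compAll fun i => T i.succ := by
  simp [compAll, List.ofFn_succ]

theorem Restricts.compAll {n : ℕ} {T : Fin n → ((σ → ℂ) → ℂ) → (σ → ℂ) → ℂ}
    {p : Fin n → MvPolynomial σ ℂ} (h : ∀ i, Restricts (T i) (symbolOp σ (p i))) :
    Restricts (compAll T) (symbolOp σ (∏ i, p i)) := by
  induction n with
  | zero => intro f; simp [PfDeriv.compAll]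
  | succ n ih =>
    intro f
    rw [compAll_succ, Function.comp_apply, ih (fun i => h i.succ), h, Fin.prod_univ_succ, map_mul,
      Module.End.mul_apply]

theorem restricts_partialDeriv (i : σ) :
    Restricts (partialDeriv i) (symbolOp σ (MvPolynomial.X i)) := by
  intro f
  rw [symbolOp_X]
  rfl

end Operators

/-! ### The operators D as derivatives along the moment curve -/

/-- The symbol of `D_{u_l, k}` as a polynomial in all the derivations. -/
noncomputable def blockSymbol {L : ℕ} (d : ℕ) (l : Fin L) (k : ℕ) : MvPolynomial (Fin L × Fin d) ℂ :=
  MvPolynomial.rename (Prod.mk l) (derivSymbol d k)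

theorem restricts_derivOp {L d : ℕ} (l : Fin L) (k : ℕ) :
    Restricts (derivOp (d := d) l k) (symbolOp _ (blockSymbol d l k)) := by
  intro f
  ext u
  have hsum : blockSymbol d l k = ∑ s ∈ (derivSymbol d k).support,
      (derivSymbol d k).coeff s • ∏ j : Fin d, (MvPolynomial.X (l, j)) ^ s j := by
    conv_lhs => rw [blockSymbol, (derivSymbol d k).as_sum, map_sum]
    refine Finset.sum_congr rfl fun s _ => ?_
    rw [MvPolynomial.rename_monomial, MvPolynomial.monomial_eq, MvPolynomial.smul_eq_C_mul,
      Finsupp.prod_mapDomain_index_inj (Prod.mk_right_injective l),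
      Finsupp.prod_fintype _ _ (by simp)]
  have hs : ∀ s : Fin d →₀ ℕ, PfDeriv.compAll (fun j : Fin d => (partialDeriv (l, j))^[s j]) f =
      symbolOp (Fin L × Fin d) (∏ j : Fin d, (MvPolynomial.X (l, j)) ^ s j) f := fun s =>
    Restricts.compAll (fun j => by
      rw [map_pow]
      exact (restricts_partialDeriv _).iterate _) f
  rw [derivOp, polyDiffOp, hsum, map_sum]
  simp only [hs, map_smul, LinearMap.sum_apply, LinearMap.smul_apply, Submodule.coe_sum,
    Finset.sum_apply]
  rfl

/-- The point `(t, t² / 2!, t³ / 3!, …)` in the variables with first index `l`. -/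
noncomputable def momentCurve {L d : ℕ} (l : Fin L) (t : ℂ) : Fin L × Fin d → ℂ :=
  fun q => if q.1 = l then t ^ ((q.2 : ℕ) + 1) / (((q.2 : ℕ) + 1).factorial : ℂ) else 0

theorem momentCurve_zero {L d : ℕ} (l : Fin L) : momentCurve (d := d) l 0 = 0 := by
  ext q
  simp [momentCurve]

theorem hasDerivAt_momentCurve {L d : ℕ} (l : Fin L) (t : ℂ) :
    HasDerivAt (momentCurve (d := d) l)
      (fun q => if q.1 = l then t ^ (q.2 : ℕ) / ((q.2 : ℕ).factorial : ℂ) else 0) t := by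
  rw [hasDerivAt_pi]
  intro q
  simp only [momentCurve]
  split_ifs
  · refine ((hasDerivAt_pow ((q.2 : ℕ) + 1) t).div_const _).congr_deriv ?_
    rw [Nat.factorial_succ]
    have : (((q.2 : ℕ).factorial : ℕ) : ℂ) ≠ 0 := Nat.cast_ne_zero.mpr (Nat.factorial_ne_zero _)
    have h2 : ((q.2 : ℕ) : ℂ) + 1 ≠ 0 := Nat.cast_add_one_ne_zero _
    push_cast
    field_simp
  · exact hasDerivAt_const _ _

/-- The vector field `∂_{u_{l,1}} + ∑_j (u_{l,j} - c_{l,j}) ∂_{u_{l,j+1}}`. -/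
noncomputable def shiftField {L d : ℕ} (l : Fin L) (c : Fin L × Fin d → ℂ) :
    Module.End ℂ (entire (Fin L × Fin d)) :=
  ∑ i : Fin d, (match i with
    | ⟨0, _⟩ => 1
    | ⟨j + 1, hj⟩ => mulCoord (l, ⟨j, Nat.lt_of_succ_lt hj⟩) (c (l, ⟨j, Nat.lt_of_succ_lt hj⟩))) *
    partialEnd (l, i)

theorem symbolOp_blockSymbol_succ {L d : ℕ} (l : Fin L) (k : ℕ) (u : Fin L × Fin d → ℂ)
    (f : entire (Fin L × Fin d)) :
    (symbolOp _ (blockSymbol d l (k + 1)) f : (Fin L × Fin d → ℂ) → ℂ) u =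
      (symbolOp _ (blockSymbol d l k) (shiftField l u f) : (Fin L × Fin d → ℂ) → ℂ) u := by
  rw [blockSymbol, derivSymbol, shiftField]
  simp only [map_sum, LinearMap.sum_apply, Submodule.coe_sum, Finset.sum_apply]
  refine Finset.sum_congr rfl fun i _ => ?_
  rw [map_mul, mul_comm, map_mul, MvPolynomial.rename_X, symbolOp_X, Module.End.mul_apply,
    Module.End.mul_apply]
  obtain ⟨i, hi⟩ := i
  cases i with
  | zero => rfl
  | succ j =>
    simp only
    rw [symbolOp_mulCoord_self, blockSymbol, MvPolynomial.pderiv_rename (Prod.mk_right_injective l)]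

/-- The velocity of the moment curve has first coordinate 1, and its coordinate j+1 is coordinate j
of the curve, that is, of the displacement from u. So the curve started at u is an integral curve of
`shiftField l u`. -/
theorem deriv_comp_momentCurve {L d : ℕ} (l : Fin L) (u : Fin L × Fin d → ℂ)
    (f : entire (Fin L × Fin d)) :
    (deriv fun t => (f : (Fin L × Fin d → ℂ) → ℂ) (u + momentCurve l t)) =
      fun t => (shiftField l u f : (Fin L × Fin d → ℂ) → ℂ) (u + momentCurve l t) := by
  ext t
  have hf := (contDiff_coe f).differentiable (by simp) (u + momentCurve l t)
  have h := hf.hasFDerivAt.comp_hasDerivAt t ((hasDerivAt_momentCurve l t).const_add u)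
  rw [show (fun t => (f : (Fin L × Fin d → ℂ) → ℂ) (u + momentCurve l t)) =
    (f : (Fin L × Fin d → ℂ) → ℂ) ∘ fun t => u + momentCurve l t from rfl, h.deriv]
  rw [← ContinuousLinearMap.coe_coe, LinearMap.pi_apply_eq_sum_univ, Fintype.sum_prod_type,
    Finset.sum_eq_single l (fun l' _ hl' => by simp [hl']) (by simp), shiftField]
  simp only [LinearMap.sum_apply, Submodule.coe_sum, Finset.sum_apply, if_true]
  refine Finset.sum_congr rfl fun i _ => ?_
  have hi : (fun q => if (l, i) = q then (1 : ℂ) else 0) = Pi.single (l, i) 1 := by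
    ext q
    simp [Pi.single_apply, eq_comm]
  rw [ContinuousLinearMap.coe_coe, hi, ← partialDeriv_eq_fderiv hf, Module.End.mul_apply]
  obtain ⟨i, hi⟩ := i
  cases i with
  | zero => simp [partialEnd]
  | succ j => simp [partialEnd, mulCoord, momentCurve]

/-- The recurrence and the chain rule both trade one order of differentiation for an application of
`shiftField l u`. Having this at every u, and not only at 0, is what permits composing several
operators. -/
theorem symbolOp_blockSymbol_eq_iteratedDeriv {L d : ℕ} (l : Fin L) (k : ℕ)
    (u : Fin L × Fin d → ℂ) (f : entire (Fin L × Fin d)) :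
    (symbolOp _ (blockSymbol d l k) f : (Fin L × Fin d → ℂ) → ℂ) u =
      iteratedDeriv k (fun t => (f : (Fin L × Fin d → ℂ) → ℂ) (u + momentCurve l t)) 0 := by
  induction k generalizing f with
  | zero => simp [blockSymbol, derivSymbol, momentCurve_zero]
  | succ k ih =>
    rw [symbolOp_blockSymbol_succ, ih, iteratedDeriv_succ', deriv_comp_momentCurve]

/-! ### Jets of order d in a commutative Banach algebra -/

/-- If f - g vanished to an order m ≤ d only, its cofactor after t^m would be nonzero at 0, while
the bound forces it to be O(t^(d+1-m)). -/
theorem iteratedDeriv_eq_of_isBigO {f g : ℂ → ℂ} {d : ℕ} (hf : AnalyticAt ℂ f 0)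
    (hg : AnalyticAt ℂ g 0) (h : (fun t => f t - g t) =O[𝓝 0] fun t : ℂ => t ^ (d + 1)) {n : ℕ}
    (hn : n ≤ d) : iteratedDeriv n f 0 = iteratedDeriv n g 0 := by
  have hfg : AnalyticAt ℂ (fun t => f t - g t) 0 := hf.fun_sub hg
  suffices hord : ((d + 1 : ℕ) : ℕ∞) ≤ analyticOrderAt (fun t => f t - g t) 0 by
    have := (natCast_le_analyticOrderAt_iff_iteratedDeriv_eq_zero hfg).mp hord n (by omega)
    rwa [iteratedDeriv_fun_sub hf.contDiffAt hg.contDiffAt, sub_eq_zero] at this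
  by_contra hlt
  push Not at hlt
  obtain ⟨m, hm⟩ := ENat.ne_top_iff_exists.mp hlt.ne_top
  rw [← hm, Nat.cast_lt] at hlt
  obtain ⟨u, hu, hu0, hfu⟩ := (hfg.analyticOrderAt_eq_natCast).mp hm.symm
  apply hu0
  obtain ⟨K, hK⟩ := h.bound
  have hlim : Tendsto u (𝓝[≠] 0) (𝓝 0) := by
    refine squeeze_zero_norm' (a := fun t => K * ‖t‖ ^ (d + 1 - m)) ?_ ?_
    · filter_upwards [nhdsWithin_le_nhds hK, nhdsWithin_le_nhds hfu, self_mem_nhdsWithin]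
        with t h1 h2 h3
      have hpos : 0 < ‖t‖ ^ m := pow_pos (norm_pos_iff.mpr h3) m
      rw [h2, sub_zero, norm_smul, norm_pow, norm_pow,
        show d + 1 = m + (d + 1 - m) by omega, pow_add, mul_left_comm] at h1
      exact le_of_mul_le_mul_left h1 hpos
    · have : Tendsto (fun t : ℂ => K * ‖t‖ ^ (d + 1 - m)) (𝓝 0) (𝓝 (K * ‖(0 : ℂ)‖ ^ (d + 1 - m))) :=
        Continuous.tendsto (by fun_prop) 0
      rw [norm_zero, zero_pow (by omega), mul_zero] at this
      exact this.mono_left nhdsWithin_le_nhds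
  exact tendsto_nhds_unique (hu.continuousAt.tendsto.mono_left nhdsWithin_le_nhds) hlim

/-- Analyticity in the parameter makes `jetOp` preserve entire functions, so that jets can be
iterated. -/
theorem contDiff_iteratedDeriv_fst {E : Type*} [NormedAddCommGroup E] [NormedSpace ℂ E]
    {F : ℂ × E → ℂ} (hF : ContDiff ℂ ω F) (n : ℕ) :
    ContDiff ℂ ω fun p : ℂ × E => iteratedDeriv n (fun t => F (t, p.2)) p.1 := by
  induction n with
  | zero => simpa using hF
  | succ n ih =>
    have : (fun p : ℂ × E => iteratedDeriv (n + 1) (fun t => F (t, p.2)) p.1) = fun p =>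
        fderiv ℂ (fun p : ℂ × E => iteratedDeriv n (fun t => F (t, p.2)) p.1) p (1, 0) := by
      ext p
      rw [iteratedDeriv_succ]
      have h1 := (ih.differentiable (by simp) p).hasFDerivAt
      have h2 : HasDerivAt (fun t : ℂ => (t, p.2)) ((1 : ℂ), (0 : E)) p.1 :=
        (hasDerivAt_id p.1).prodMk (hasDerivAt_const _ _)
      exact (HasFDerivAt.comp_hasDerivAt_of_eq p.1 h1 h2 rfl).deriv
    rw [this]
    exact (ih.fderiv_right (by simp)).clm_apply contDiff_const

section Jet

variable {R : Type*} [NormedCommRing R] [NormedAlgebra ℂ R] [CompleteSpace R]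

variable (R) in
theorem contDiff_normedSpace_exp {n : WithTop ℕ∞} :
    ContDiff ℂ n (NormedSpace.exp : R → R) :=
  contDiff_iff_contDiffAt.mpr fun x => (NormedSpace.exp_analytic x).contDiffAt

/-- The truncation `∑_{j ≤ d} (t a)^j / j` of `- log (1 - t a)`. -/
noncomputable def logPoly {R : Type*} [NormedCommRing R] [NormedAlgebra ℂ R] (d : ℕ) (a : R)
    (t : ℂ) : R :=
  ∑ j : Fin d, (t ^ ((j : ℕ) + 1) / ((j : ℕ) + 1)) • a ^ ((j : ℕ) + 1)

omit [CompleteSpace R] in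
theorem contDiff_logPoly {d : ℕ} {a : R} {n : WithTop ℕ∞} : ContDiff ℂ n (logPoly d a) := by
  unfold logPoly
  fun_prop

omit [CompleteSpace R] in
theorem hasDerivAt_logPoly (d : ℕ) (a : R) (t : ℂ) :
    HasDerivAt (logPoly d a) (∑ j : Fin d, t ^ (j : ℕ) • a ^ ((j : ℕ) + 1)) t := by
  unfold logPoly
  refine HasDerivAt.fun_sum fun j _ => ?_
  refine ((((hasDerivAt_pow ((j : ℕ) + 1) t)).div_const _).smul_const _).congr_deriv ?_
  have h2 : ((j : ℕ) : ℂ) + 1 ≠ 0 := Nat.cast_add_one_ne_zero _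
  push_cast
  field_simp

omit [CompleteSpace R] in
theorem logPoly_zero (d : ℕ) (a : R) : logPoly d a 0 = 0 := by simp [logPoly]

/-- The `n`-th derivative at `t = 0` of `Ψ (w / (1 - t a))`, where `1 / (1 - t a)` is replaced by
the exponential of its truncated logarithm. -/
noncomputable def jetOp (d : ℕ) (a : R) (n : ℕ) (Ψ : R → ℂ) (w : R) : ℂ :=
  iteratedDeriv n (fun t => Ψ (w * NormedSpace.exp (logPoly d a t))) 0

theorem contDiff_jetOp {d : ℕ} {a : R} {n : ℕ} {Ψ : R → ℂ} (hΨ : ContDiff ℂ ω Ψ) :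
    ContDiff ℂ ω (jetOp d a n Ψ) := by
  have hF : ContDiff ℂ ω fun p : ℂ × R => Ψ (p.2 * NormedSpace.exp (logPoly d a p.1)) :=
    hΨ.comp (contDiff_snd.mul ((contDiff_normedSpace_exp R).comp
      (contDiff_logPoly.comp contDiff_fst)))
  exact (contDiff_iteratedDeriv_fst hF n).comp (contDiff_const.prodMk contDiff_id)

/-- By the geometric sum, the derivative of exp(`logPoly`) (1 - t a) is -t^d a^(d+1) exp(`logPoly`),
which has order at least d. Integrating raises the order by one. -/
theorem natCast_le_analyticOrderAt_exp_logPoly (d : ℕ) (a : R) : ((d + 1 : ℕ) : ℕ∞) ≤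
    analyticOrderAt (fun t : ℂ => NormedSpace.exp (logPoly d a t) * (1 - t • a) - 1) 0 := by
  have hexp : ∀ t, HasDerivAt (fun t : ℂ => NormedSpace.exp (logPoly d a t))
      (NormedSpace.exp (logPoly d a t) * ∑ j : Fin d, t ^ (j : ℕ) • a ^ ((j : ℕ) + 1)) t :=
    fun t => ((hasFDerivAt_exp (𝕂 := ℂ)).comp_hasDerivAt t (hasDerivAt_logPoly d a t)).congr_deriv
      (by rw [smul_apply, one_apply_eq_self, smul_eq_mul])
  have hgeom : ∀ t : ℂ, (∑ j : Fin d, t ^ (j : ℕ) • a ^ ((j : ℕ) + 1)) * (1 - t • a) - a =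
      t ^ d • -a ^ (d + 1) := by
    intro t
    have h1 : (∑ j : Fin d, t ^ (j : ℕ) • a ^ ((j : ℕ) + 1)) =
        a * ∑ j ∈ Finset.range d, (t • a) ^ j := by
      rw [Fin.sum_univ_eq_sum_range (fun j => t ^ j • a ^ (j + 1)) d, Finset.mul_sum]
      exact Finset.sum_congr rfl fun j _ => by rw [smul_pow, mul_smul_comm, pow_succ']
    rw [h1, mul_assoc, geom_sum_mul_neg, mul_sub, smul_pow, mul_smul_comm, pow_succ', smul_neg]
    simp
  have hder : ∀ t, HasDerivAt (fun t : ℂ => NormedSpace.exp (logPoly d a t) * (1 - t • a) - 1)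
      (t ^ d • (NormedSpace.exp (logPoly d a t) * -a ^ (d + 1))) t := by
    intro t
    have h2 : HasDerivAt (fun t : ℂ => 1 - t • a) (-a) t := by
      simpa using ((hasDerivAt_id t).smul_const a).const_sub 1
    refine (((hexp t).mul h2).sub_const 1).congr_deriv ?_
    rw [← mul_smul_comm, ← hgeom]
    ring
  have han : ContDiff ℂ ω fun t : ℂ => NormedSpace.exp (logPoly d a t) :=
    (contDiff_normedSpace_exp R).comp contDiff_logPoly
  have han0 : AnalyticAt ℂ (fun t : ℂ => NormedSpace.exp (logPoly d a t)) 0 :=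
    han.contDiffAt.analyticAt
  rw [Nat.cast_add, Nat.cast_one, ← analyticOrderAt_deriv_ge_iff, natCast_le_analyticOrderAt]
  · refine ⟨fun t => NormedSpace.exp (logPoly d a t) * -a ^ (d + 1), by fun_prop, ?_⟩
    exact Eventually.of_forall fun t => by rw [(hder t).deriv, sub_zero]
  · rw [funext fun t => (hder t).deriv]
    fun_prop
  · fun_prop
  · simp [logPoly_zero]

/-- The curves w / (1 - t a) and w exp(`logPoly`) differ by O(t^(d+1)), and Ψ is locally Lipschitz.
-/
theorem iteratedDeriv_comp_eq_jetOp {d n : ℕ} (hn : n ≤ d) {a w : R} {Ψ : R → ℂ}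
    (hΨ : ContDiff ℂ ω Ψ) {c : ℂ → R} (hc : ∀ᶠ t in 𝓝 0, c t * (1 - t • a) = w) :
    iteratedDeriv n (fun t => Ψ (c t)) 0 = jetOp d a n Ψ w := by
  have hone : AnalyticAt ℂ (fun t : ℂ => Ring.inverse (1 - t • a)) 0 := by
    refine AnalyticAt.fun_comp ?_ (by fun_prop)
    rw [zero_smul, sub_zero]
    exact analyticAt_inverse (1 : Rˣ)
  have hunit : ∀ᶠ t : ℂ in 𝓝 0, IsUnit (1 - t • a) := by
    have : Tendsto (fun t : ℂ => 1 - t • a) (𝓝 0) (𝓝 1) := by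
      have h : Continuous fun t : ℂ => 1 - t • a := by fun_prop
      simpa using h.tendsto 0
    exact this.eventually (Units.nhds 1)
  have hceq : ∀ᶠ t in 𝓝 0, c t = w * Ring.inverse (1 - t • a) := by
    filter_upwards [hc, hunit] with t h1 h2
    rw [← h1, mul_assoc, Ring.mul_inverse_cancel _ h2, mul_one]
  have hcan : AnalyticAt ℂ c 0 := by
    refine AnalyticAt.congr (f := fun t => w * Ring.inverse (1 - t • a)) (by fun_prop) ?_
    filter_upwards [hceq] with t ht using ht.symm
  have hc0 : c 0 = w := by simpa using hc.self_of_nhds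
  have hΨan : ∀ x, AnalyticAt ℂ Ψ x := fun x => hΨ.contDiffAt.analyticAt
  have heC : ContDiff ℂ ω fun t : ℂ => w * NormedSpace.exp (logPoly d a t) :=
    contDiff_const.mul ((contDiff_normedSpace_exp R).comp contDiff_logPoly)
  have hean : AnalyticAt ℂ (fun t : ℂ => w * NormedSpace.exp (logPoly d a t)) 0 :=
    heC.contDiffAt.analyticAt
  have he0 : w * NormedSpace.exp (logPoly d a 0) = w := by simp [logPoly_zero]
  refine iteratedDeriv_eq_of_isBigO (d := d) ((hΨan _).fun_comp hcan)
    (AnalyticAt.fun_comp (hΨan _) hean) ?_ hn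
  have hlip := ((hΨan w).hasStrictFDerivAt).isBigO_sub
  have htend : Tendsto (fun t : ℂ => (c t, w * NormedSpace.exp (logPoly d a t))) (𝓝 0)
      (𝓝 (w, w)) := by
    have h1 := hcan.continuousAt.tendsto
    have h2 := hean.continuousAt.tendsto
    rw [hc0] at h1
    rw [he0] at h2
    exact h1.prodMk_nhds h2
  refine (hlip.comp_tendsto htend).trans ?_
  -- With exp(`logPoly`) (1 - t a) - 1 = t^(d+1) g and w = c (1 - t a), the difference of the curves
  -- is -t^(d+1) c g.
  obtain ⟨g, hg, hgeq⟩ := (natCast_le_analyticOrderAt (by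
    have : ContDiff ℂ ω fun t : ℂ => NormedSpace.exp (logPoly d a t) * (1 - t • a) - 1 :=
      (((contDiff_normedSpace_exp R).comp contDiff_logPoly).mul
        (by fun_prop)).sub contDiff_const
    exact this.contDiffAt.analyticAt)).mp (natCast_le_analyticOrderAt_exp_logPoly d a)
  have hbound : (fun t : ℂ => -(c t * g t)) =O[𝓝 0] fun _ => (1 : ℂ) :=
    ((hcan.continuousAt.mul hg.continuousAt).neg).isBigO_one ℂ
  have hpow : (fun t : ℂ => t ^ (d + 1) • -(c t * g t)) =O[𝓝 0] fun t : ℂ => t ^ (d + 1) • (1 : ℂ) :=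
    (Asymptotics.isBigO_refl _ _).smul hbound
  refine (hpow.congr' ?_ (by simp))
  filter_upwards [hc, hgeq] with t h1 h2
  simp only [Function.comp_apply]
  rw [sub_zero] at h2
  rw [smul_neg, ← mul_smul_comm, ← h2, ← h1]
  ring

/-- The function `w₀ exp (∑ (j-1)! u_{l,j} a_l^j)`. -/
noncomputable def expWeight {L : ℕ} (d : ℕ) (a : Fin L → R) (w₀ : R) (u : Fin L × Fin d → ℂ) : R :=
  w₀ * NormedSpace.exp (∑ q : Fin L × Fin d,
    (((q.2 : ℕ).factorial : ℂ) * u q) • a q.1 ^ ((q.2 : ℕ) + 1))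

theorem contDiff_expWeight {L d : ℕ} (a : Fin L → R) (w₀ : R) {n : WithTop ℕ∞} :
    ContDiff ℂ n (expWeight d a w₀) := by
  refine contDiff_const.mul ((contDiff_normedSpace_exp R).comp ?_)
  fun_prop

/-- The exponent is linear in u, and (j-1)! · t^j / j! = t^j / j is the coefficient in `logPoly`. -/
theorem expWeight_add_momentCurve {L d : ℕ} (a : Fin L → R) (w₀ : R) (u : Fin L × Fin d → ℂ)
    (l : Fin L) (t : ℂ) : expWeight d a w₀ (u + momentCurve l t) =
      expWeight d a w₀ u * NormedSpace.exp (logPoly d (a l) t) := by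
  let _ : NormedAlgebra ℚ R := NormedAlgebra.restrictScalars ℚ ℂ R
  rw [expWeight, expWeight, mul_assoc, ← NormedSpace.exp_add]
  congr 2
  simp only [Pi.add_apply, mul_add, add_smul, Finset.sum_add_distrib]
  congr 1
  rw [Fintype.sum_prod_type, Finset.sum_eq_single l (fun l' _ hl' => by simp [momentCurve, hl'])
    (by simp), logPoly]
  refine Finset.sum_congr rfl fun j _ => ?_
  congr 1
  have h1 : (((j : ℕ).factorial : ℕ) : ℂ) ≠ 0 := Nat.cast_ne_zero.mpr (Nat.factorial_ne_zero _)
  have h2 : ((j : ℕ) : ℂ) + 1 ≠ 0 := Nat.cast_add_one_ne_zero _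
  simp only [momentCurve, if_true, Nat.factorial_succ]
  push_cast
  field_simp

/-- The composition of `Ψ` with `expWeight`, as an entire function. -/
noncomputable def entireComp {L : ℕ} (d : ℕ) (a : Fin L → R) (w₀ : R) {Ψ : R → ℂ}
    (hΨ : ContDiff ℂ ω Ψ) : entire (Fin L × Fin d) :=
  ⟨fun u => Ψ (expWeight d a w₀ u), hΨ.comp (contDiff_expWeight a w₀)⟩

/-- The result is again a function of the weight alone, so the next operator acts in the same way.
-/
theorem symbolOp_blockSymbol_entireComp {L d : ℕ} (a : Fin L → R) (w₀ : R) {Ψ : R → ℂ}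
    (hΨ : ContDiff ℂ ω Ψ) (l : Fin L) (n : ℕ) :
    symbolOp _ (blockSymbol d l n) (entireComp d a w₀ hΨ) =
      entireComp d a w₀ (contDiff_jetOp (d := d) (a := a l) (n := n) hΨ) := by
  ext u
  rw [symbolOp_blockSymbol_eq_iteratedDeriv]
  simp only [entireComp, jetOp, expWeight_add_momentCurve]

end Jet

/-! ### Partial derivatives near the limit point -/

theorem partialDeriv_iterate {σ : Type*} [DecidableEq σ] (i : σ) (m : ℕ) (f : (σ → ℂ) → ℂ)
    (x : σ → ℂ) :
    (partialDeriv i)^[m] f x = iteratedDeriv m (fun s => f (Function.update x i s)) (x i) := by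
  induction m generalizing x with
  | zero => simp
  | succ m ih =>
    rw [Function.iterate_succ_apply', iteratedDeriv_succ, partialDeriv]
    congr 1
    ext s
    rw [ih]
    simp

section Local

variable {σ : Type*} [Fintype σ] [DecidableEq σ]

omit [Fintype σ] in
theorem eventuallyEq_partialDeriv {i : σ} {f g : (σ → ℂ) → ℂ} {x : σ → ℂ} (h : f =ᶠ[𝓝 x] g) :
    partialDeriv i f =ᶠ[𝓝 x] partialDeriv i g := by
  filter_upwards [h.eventuallyEq_nhds] with y hy
  refine Filter.EventuallyEq.deriv_eq ?_
  have : Tendsto (fun t => Function.update y i t) (𝓝 (y i)) (𝓝 y) := by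
    have h : Continuous fun t => Function.update y i t := by fun_prop
    simpa using h.tendsto (y i)
  exact this.eventually hy

theorem contDiffAt_partialDeriv {i : σ} {f : (σ → ℂ) → ℂ} {x : σ → ℂ} (h : ContDiffAt ℂ ω f x) :
    ContDiffAt ℂ ω (partialDeriv i f) x := by
  have h1 : (fun y => fderiv ℂ f y (Pi.single i 1)) =ᶠ[𝓝 x] partialDeriv i f := by
    filter_upwards [h.eventually (by simp)] with y hy
    exact (partialDeriv_eq_fderiv (hy.differentiableAt (by simp))).symm
  exact ((h.fderiv_right (m := ω) (by simp)).clm_apply contDiffAt_const).congr_of_eventuallyEq h1.symm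

/-- The composition of the iterated partial derivatives along a list of variables. -/
noncomputable def partialList (n : σ → ℕ) (l : List σ) (f : (σ → ℂ) → ℂ) : (σ → ℂ) → ℂ :=
  l.foldr (fun i g => (partialDeriv i)^[n i] g) f

omit [Fintype σ] in
theorem eventuallyEq_partialList {n : σ → ℕ} {l : List σ} {f g : (σ → ℂ) → ℂ} {x : σ → ℂ}
    (h : f =ᶠ[𝓝 x] g) : partialList n l f =ᶠ[𝓝 x] partialList n l g := by
  induction l with
  | nil => exact h
  | cons i l ih =>
    change (partialDeriv i)^[n i] (partialList n l f) =ᶠ[𝓝 x]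
      (partialDeriv i)^[n i] (partialList n l g)
    induction n i with
    | zero => exact ih
    | succ m ihm =>
      rw [Function.iterate_succ_apply', Function.iterate_succ_apply']
      exact eventuallyEq_partialDeriv ihm

theorem contDiffAt_partialList {n : σ → ℕ} {l : List σ} {f : (σ → ℂ) → ℂ} {x : σ → ℂ}
    (h : ContDiffAt ℂ ω f x) : ContDiffAt ℂ ω (partialList n l f) x := by
  induction l with
  | nil => exact h
  | cons i l ih =>
    change ContDiffAt ℂ ω ((partialDeriv i)^[n i] (partialList n l f)) x
    induction n i with
    | zero => exact ih
    | succ m ihm =>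
      rw [Function.iterate_succ_apply']
      exact contDiffAt_partialDeriv ihm

/-- The composition of jet operators along a list of variables. -/
noncomputable def jetList {R : Type*} [NormedCommRing R] [NormedAlgebra ℂ R] (d : ℕ) (a : σ → R)
    (n : σ → ℕ) (l : List σ) (Ψ : R → ℂ) : R → ℂ :=
  l.foldr (fun i g => jetOp d (a i) (n i) g) Ψ

variable {R : Type*} [NormedCommRing R] [NormedAlgebra ℂ R] [CompleteSpace R]

omit [Fintype σ] [DecidableEq σ] in
theorem contDiff_jetList {d : ℕ} {a : σ → R} {n : σ → ℕ} {l : List σ} {Ψ : R → ℂ}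
    (hΨ : ContDiff ℂ ω Ψ) : ContDiff ℂ ω (jetList d a n l Ψ) := by
  induction l with
  | nil => exact hΨ
  | cons i l ih => exact contDiff_jetOp ih

omit [Fintype σ] in
-- The fixed element `a i` describes the motion of x_i only from its limit value, so the coordinates
-- in l are pinned there while the others stay free. Differentiating in a new variable k moves x_k
-- alone, which is still free in the induction hypothesis.
theorem partialList_comp_eq_jetList {d : ℕ} {a : σ → R} {n : σ → ℕ} (hn : ∀ i, n i ≤ d) {l : List σ}
    (hl : l.Nodup) {Ψ : R → ℂ} (hΨ : ContDiff ℂ ω Ψ) {W : (σ → ℂ) → R} {x₀ : σ → ℂ}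
    (hW : ∀ i, ∀ᶠ x in 𝓝 x₀, x i = x₀ i →
      ∀ᶠ t in 𝓝 (0 : ℂ), W (Function.update x i (x i + t)) * (1 - t • a i) = W x) :
    ∀ᶠ x in 𝓝 x₀, (∀ i ∈ l, x i = x₀ i) →
      partialList n l (fun x => Ψ (W x)) x = jetList d a n l Ψ (W x) := by
  induction l with
  | nil => exact Eventually.of_forall fun x _ => rfl
  | cons k l ih =>
    rw [List.nodup_cons] at hl
    filter_upwards [(ih hl.2).eventually_nhds, hW k] with x hx hWx hxl
    have hk : x k = x₀ k := hxl k (by simp)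
    change (partialDeriv k)^[n k] (partialList n l fun x => Ψ (W x)) x =
      jetOp d (a k) (n k) (jetList d a n l Ψ) (W x)
    rw [partialDeriv_iterate, ← iteratedDeriv_comp_eq_jetOp (hn k) (contDiff_jetList hΨ) (hWx hk)]
    have hshift := congrFun (iteratedDeriv_comp_const_add (n k)
      (fun s => jetList d a n l Ψ (W (Function.update x k s))) (x k)) 0
    rw [add_zero] at hshift
    rw [hshift]
    refine Filter.EventuallyEq.iteratedDeriv_eq _ ?_
    have : Tendsto (fun t => Function.update x k t) (𝓝 (x k)) (𝓝 x) := by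
      have h : Continuous fun t => Function.update x k t := by fun_prop
      simpa using h.tendsto (x k)
    filter_upwards [this.eventually hx] with s hs
    refine hs fun i hi => ?_
    have hik : i ≠ k := fun h => hl.1 (h ▸ hi)
    rw [Function.update_of_ne hik]
    exact hxl i (by simp [hi])

end Local

/-! ### Matching the products of operators -/

theorem compAll_iterate_partialDeriv {P : ℕ} (n : Fin P → ℕ) (f : (Fin P → ℂ) → ℂ) :
    compAll (fun i : Fin P => (partialDeriv i)^[n i]) f = partialList n (List.finRange P) f := by
  rw [compAll, List.ofFn_eq_map, partialList]
  induction List.finRange P with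
  | nil => rfl
  | cons i l ih => simp [ih]

theorem symbolOp_prod_entireComp {R : Type*} [NormedCommRing R] [NormedAlgebra ℂ R]
    [CompleteSpace R] {L d P : ℕ} (a : Fin L → R) (w₀ : R) {Ψ : R → ℂ} (hΨ : ContDiff ℂ ω Ψ)
    (ψ : Fin P → Fin L) (n : Fin P → ℕ) (l : List (Fin P)) :
    symbolOp _ (l.map fun i => blockSymbol d (ψ i) (n i)).prod (entireComp d a w₀ hΨ) =
      entireComp d a w₀ (contDiff_jetList (d := d) (a := fun i => a (ψ i)) (n := n) (l := l) hΨ) := by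
  induction l with
  | nil => simp [jetList]
  | cons i l ih =>
    rw [List.map_cons, List.prod_cons, map_mul, Module.End.mul_apply, ih,
      symbolOp_blockSymbol_entireComp]
    rfl

/-- The indices i are grouped by (ψ i, n i); the groups with n i = 0 contribute nothing because
D_{u_l,0} = 1. -/
theorem prod_blockSymbol_eq {L d P : ℕ} (ψ : Fin P → Fin L) {n : Fin P → ℕ} (hn : ∀ i, n i ≤ d) :
    ((List.finRange P).map fun i => blockSymbol d (ψ i) (n i)).prod =
      ∏ l : Fin L, ∏ k : Fin d, blockSymbol d l ((k : ℕ) + 1) ^ mult ψ n l ((k : ℕ) + 1) := by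
  have h1 : ((List.finRange P).map fun i => blockSymbol d (ψ i) (n i)).prod =
      ∏ i, blockSymbol d (ψ i) (n i) := by
    rw [← List.ofFn_eq_map, List.prod_ofFn]
  rw [h1, ← Finset.prod_fiberwise_of_maps_to (s := Finset.univ)
    (t := (Finset.univ : Finset (Fin L × Fin (d + 1))))
    (g := fun i => (ψ i, ⟨n i, Nat.lt_succ_of_le (hn i)⟩)) (by simp), Fintype.prod_prod_type]
  refine Finset.prod_congr rfl fun l _ => ?_
  have h2 : ∀ k : Fin (d + 1), ∏ i with (ψ i, (⟨n i, Nat.lt_succ_of_le (hn i)⟩ : Fin (d + 1))) =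
      (l, k), blockSymbol d (ψ i) (n i) = blockSymbol d l k ^ mult ψ n l k := by
    intro k
    rw [mult, ← Finset.prod_const]
    refine Finset.prod_congr ?_ fun i hi => ?_
    · ext i
      simp [Fin.ext_iff]
    · simp only [Finset.mem_filter] at hi
      rw [hi.2.1, hi.2.2]
  rw [Finset.prod_congr rfl fun k _ => h2 k, Fin.prod_univ_succ]
  simp [blockSymbol, derivSymbol]

/-! ### The weight ∏ (z - x_i)⁻¹ on the circles -/

section Resolvent

variable {L P : ℕ} {χ : Fin L → ℂ} {r : Fin L → ℝ}

variable (χ r) in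
/-- The coordinate function on the union of the circles. -/
def coordFun : C(circles χ r, ℂ) := ⟨fun z => z, continuous_subtype_val⟩

variable (χ r) in
/-- The function `∏ (z - x_i)⁻¹` on the union of the circles. -/
noncomputable def resolventProd (x : Fin P → ℂ) : C(circles χ r, ℂ) :=
  Ring.inverse (∏ i, (coordFun χ r - x i • 1))

theorem ringInverse_apply {g : C(circles χ r, ℂ)} (hg : ∀ z, g z ≠ 0) (z : circles χ r) :
    Ring.inverse g z = (g z)⁻¹ := by
  have h := Ring.mul_inverse_cancel g ((ContinuousMap.isUnit_iff_forall_ne_zero g).mpr hg)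
  exact eq_inv_of_mul_eq_one_right (by rw [← ContinuousMap.mul_apply, h, ContinuousMap.one_apply])

theorem prod_coordFun_apply (x : Fin P → ℂ) (z : circles χ r) :
    (∏ i, (coordFun χ r - x i • 1)) z = ∏ i, ((z : ℂ) - x i) := by
  simp [coordFun]

theorem prod_coordFun_ne_zero {x : Fin P → ℂ} (hx : ∀ i, x i ∉ circles χ r) (z : circles χ r) :
    (∏ i, (coordFun χ r - x i • 1)) z ≠ 0 := by
  rw [prod_coordFun_apply]
  exact Finset.prod_ne_zero_iff.mpr fun i _ => sub_ne_zero.mpr fun h => hx i (h ▸ z.2)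

theorem resolventProd_apply {x : Fin P → ℂ} (hx : ∀ i, x i ∉ circles χ r) (z : circles χ r) :
    resolventProd χ r x z = (∏ i, ((z : ℂ) - x i))⁻¹ := by
  rw [resolventProd, ringInverse_apply (prod_coordFun_ne_zero hx), prod_coordFun_apply]

theorem contDiffAt_resolventProd {x : Fin P → ℂ} (hx : ∀ i, x i ∉ circles χ r) :
    ContDiffAt ℂ ω (resolventProd χ r) x := by
  have hu : IsUnit (∏ i, (coordFun χ r - x i • 1)) :=
    (ContinuousMap.isUnit_iff_forall_ne_zero _).mpr (prod_coordFun_ne_zero hx)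
  obtain ⟨u, hu⟩ := hu
  refine ContDiffAt.comp x (g := Ring.inverse)
    (f := fun x : Fin P → ℂ => ∏ i, (coordFun χ r - x i • 1)) ?_ ?_
  · rw [← hu]
    exact contDiffAt_ringInverse ℂ u
  · refine ContDiff.contDiffAt (contDiff_prod fun i _ => ?_)
    fun_prop

theorem notMem_circles_of_mem_ball (hr : ∀ l, 0 < r l) (hdisj : ∀ l l', l ≠ l' →
    Disjoint (Metric.closedBall (χ l) (r l)) (Metric.closedBall (χ l') (r l'))) {l : Fin L} {x : ℂ}
    (hx : x ∈ Metric.ball (χ l) (r l)) : x ∉ circles χ r := by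
  intro h
  obtain ⟨l', hl'⟩ := Set.mem_iUnion.mp h
  rw [abs_of_pos (hr l')] at hl'
  by_cases h : l' = l
  · subst h
    exact (Metric.mem_ball.mp hx).ne hl'
  · exact Set.disjoint_left.mp (hdisj _ _ h) (Metric.sphere_subset_closedBall hl')
      (Metric.ball_subset_closedBall hx)

/-- Pointwise this is z - x_i - t = (z - x_i) (1 - t / (z - x_i)). -/
theorem resolventProd_update_mul {x : Fin P → ℂ} {i : Fin P} {t : ℂ}
    (hx : ∀ j, x j ∉ circles χ r) (hxt : x i + t ∉ circles χ r) :
    resolventProd χ r (Function.update x i (x i + t)) *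
      (1 - t • Ring.inverse (coordFun χ r - x i • 1)) = resolventProd χ r x := by
  have hupd : ∀ j, Function.update x i (x i + t) j ∉ circles χ r := by
    intro j
    by_cases h : j = i
    · subst h; simpa using hxt
    · simpa [h] using hx j
  ext z
  have hinv : Ring.inverse (coordFun χ r - x i • 1) z = ((z : ℂ) - x i)⁻¹ := by
    rw [ringInverse_apply fun z => ?_]
    · simp [coordFun]
    · simpa [coordFun] using sub_ne_zero.mpr fun h : (z : ℂ) = x i => hx i (h ▸ z.2)
  have h1 : (z : ℂ) - x i ≠ 0 := sub_ne_zero.mpr fun h => hx i (h ▸ z.2)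
  have h2 : (z : ℂ) - (x i + t) ≠ 0 := sub_ne_zero.mpr fun h => hxt (h ▸ z.2)
  have h3 : ∏ j ∈ Finset.univ.erase i, ((z : ℂ) - x j) ≠ 0 :=
    Finset.prod_ne_zero_iff.mpr fun j _ => sub_ne_zero.mpr fun h => hx j (h ▸ z.2)
  have h4 : ∏ j ∈ Finset.univ.erase i, ((z : ℂ) - Function.update x i (x i + t) j) =
      ∏ j ∈ Finset.univ.erase i, ((z : ℂ) - x j) :=
    Finset.prod_congr rfl fun j hj => by rw [Function.update_of_ne (Finset.ne_of_mem_erase hj)]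
  rw [ContinuousMap.mul_apply, resolventProd_apply hupd, resolventProd_apply hx,
    ← Finset.mul_prod_erase _ _ (Finset.mem_univ i), h4,
    ← Finset.mul_prod_erase Finset.univ (fun j => (z : ℂ) - x j) (Finset.mem_univ i),
    Function.update_self]
  simp only [ContinuousMap.sub_apply, ContinuousMap.one_apply, ContinuousMap.smul_apply, hinv,
    smul_eq_mul]
  field_simp
  ring

end Resolvent

/-! ### Both Pfaffians as values of one function of the weight -/

section Admissible

variable {P Q N L d : ℕ} {χ : Fin L → ℂ} {A : ℂ → ℂ → ℂ} {B : Fin Q → ℂ → ℂ} {r : Fin L → ℝ}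

/-- The kernel `A` on the product of the circles. -/
noncomputable def IsAdmissible.kernel (hr : IsAdmissible χ A B r) :
    C(circles χ r, C(circles χ r, ℂ)) :=
  ContinuousMap.curry ⟨fun p : circles χ r × circles χ r => A p.1 p.2,
    hr.analytic_A.continuousOn.comp_continuous (f := fun p : circles χ r × circles χ r =>
      ((p.1 : ℂ), (p.2 : ℂ))) (by fun_prop) fun p =>
      ⟨circles_subset_discs hr.pos p.1.2, circles_subset_discs hr.pos p.2.2⟩⟩

theorem IsAdmissible.kernel_apply (hr : IsAdmissible χ A B r) (z w : circles χ r) :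
    hr.kernel z w = A z w := rfl

/-- The functions `B_b` on the circles. -/
noncomputable def IsAdmissible.border (hr : IsAdmissible χ A B r) (b : Fin Q) : C(circles χ r, ℂ) :=
  ⟨fun z => B b z, (hr.analytic_B b).continuousOn.comp_continuous continuous_subtype_val
    fun z => circles_subset_discs hr.pos z.2⟩

/-- The Pfaffian of the contour transforms with a general weight in place of the exponential
divided by the product. -/
noncomputable def IsAdmissible.weightFun (hr : IsAdmissible χ A B r) (h : P + Q = 2 * N)
    (C : Matrix (Fin Q) (Fin Q) ℂ) : C(circles χ r, ℂ) → ℂ :=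
  weightPfaffian h (fun α : Fin P => momentCLM χ r (P - ((α : ℕ) + 1))) hr.kernel hr.border C

theorem IsAdmissible.center_notMem (hr : IsAdmissible χ A B r) (l : Fin L) : χ l ∉ circles χ r :=
  notMem_circles_of_mem_ball hr.pos hr.disjoint (Metric.mem_ball_self (hr.pos l))

/-- The weight `exp (∑ F_l) / ∏ (ζ - χ_l)^{P_l}` of the transform. -/
noncomputable def transformWeight (d : ℕ) (ψ : Fin P → Fin L) (χ : Fin L → ℂ) (r : Fin L → ℝ) :
    (Fin L × Fin d → ℂ) → C(circles χ r, ℂ) :=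
  expWeight d (fun l => Ring.inverse (coordFun χ r - χ l • 1)) (resolventProd χ r fun i => χ (ψ i))

/-- Evaluation at z is a continuous algebra homomorphism, so it commutes with the exponential;
grouping the factors z - χ_{ψ i} by fibres of ψ gives the exponents P_l. -/
theorem transformWeight_apply (hr : IsAdmissible χ A B r) (ψ : Fin P → Fin L)
    (u : Fin L × Fin d → ℂ) (z : circles χ r) : transformWeight d ψ χ r u z =
      Complex.exp (∑ l, expFun χ u l z) / ∏ l, ((z : ℂ) - χ l) ^ fiberCard ψ l := by
  have hz : ∀ l, Ring.inverse (coordFun χ r - χ l • 1) z = ((z : ℂ) - χ l)⁻¹ := by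
    intro l
    rw [ringInverse_apply fun z => ?_]
    · simp [coordFun]
    · simpa [coordFun] using sub_ne_zero.mpr fun h : (z : ℂ) = χ l => hr.center_notMem l (h ▸ z.2)
  have hexp : ∀ g : C(circles χ r, ℂ), NormedSpace.exp g z = Complex.exp (g z) := by
    intro g
    rw [Complex.exp_eq_exp_ℂ]
    exact NormedSpace.map_exp_of_mem_ball (𝕂 := ℂ) (ContinuousMap.evalAlgHom ℂ ℂ z)
      (continuous_eval_const z) g
      ((NormedSpace.expSeries_radius_eq_top ℂ C(circles χ r, ℂ)).symm ▸ edist_lt_top _ _)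
  rw [transformWeight, expWeight, ContinuousMap.mul_apply, hexp,
    resolventProd_apply fun i => hr.center_notMem _, mul_comm, div_eq_mul_inv]
  congr 2
  · rw [Fintype.sum_prod_type]
    simp [hz, expFun, div_eq_mul_inv]
  · rw [← Finset.prod_fiberwise Finset.univ ψ]
    refine Finset.prod_congr rfl fun l _ => ?_
    rw [fiberCard, ← Finset.prod_const]
    exact Finset.prod_congr rfl fun i hi => by rw [(Finset.mem_filter.mp hi).2]

theorem transform_eq_momentCLM (hr : IsAdmissible χ A B r) (ψ : Fin P → Fin L) (α : Fin P)
    {f : ℂ → ℂ} {g : C(circles χ r, ℂ)} (hfg : ∀ z, g z = f z) (u : Fin L × Fin d → ℂ) :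
    transform ψ χ r α f u =
      momentCLM χ r (P - ((α : ℕ) + 1)) (g * transformWeight d ψ χ r u) := by
  rw [transform, momentCLM_apply]
  intro z
  rw [ContinuousMap.mul_apply, transformWeight_apply hr, hfg]
  ring

theorem transformedPfaffian_eq (hr : IsAdmissible χ A B r) (h : P + Q = 2 * N)
    (ψ : Fin P → Fin L) (C : Matrix (Fin Q) (Fin Q) ℂ) (u : Fin L × Fin d → ℂ) :
    transformedPfaffian h ψ χ r A B C u = hr.weightFun h C (transformWeight d ψ χ r u) := by
  rw [transformedPfaffian, IsAdmissible.weightFun, weightPfaffian]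
  congr 2
  · ext α γ
    simp only [Matrix.of_apply, transformTensor]
    rw [mul_comm]
    refine transform_eq_momentCLM hr ψ α (fun z => ?_) u
    rw [kernelCLM_apply]
    exact (transform_eq_momentCLM hr ψ γ (hr.kernel_apply z) u).symm
  · ext α e
    exact transform_eq_momentCLM hr ψ α (fun _ => rfl) u

theorem momentCLM_resolventProd (hr : IsAdmissible χ A B r) (ψ : Fin P → Fin L) {x : Fin P → ℂ}
    (hinj : Function.Injective x) (hx : ∀ i, x i ∈ Metric.ball (χ (ψ i)) (r (ψ i))) (α : Fin P)
    {f : ℂ → ℂ} (hf : DifferentiableOn ℂ f (discs χ r)) {g : C(circles χ r, ℂ)}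
    (hfg : ∀ z, g z = f z) :
    momentCLM χ r (P - ((α : ℕ) + 1)) (g * resolventProd χ r x) =
      ∑ i, residueMatrix x α i * f (x i) := by
  have : NeZero P := ⟨by have := α.2; omega⟩
  rw [momentCLM_apply _ _ (fun z => (z ^ (P - ((α : ℕ) + 1)) * f z) * ∏ i, (z - x i)⁻¹),
    contourIntegral_prod_inv_sub hr.pos hr.disjoint (f := fun z => z ^ (P - ((α : ℕ) + 1)) * f z)
      (DifferentiableOn.fun_mul (by fun_prop) hf) ψ hinj hx]
  · refine Finset.sum_congr rfl fun i _ => ?_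
    rw [residueMatrix, Matrix.of_apply]
    ring
  · intro z
    rw [ContinuousMap.mul_apply, resolventProd_apply fun i =>
      notMem_circles_of_mem_ball hr.pos hr.disjoint (hx i), hfg, Finset.prod_inv_distrib]
    ring

/-- Evaluating the contour integrals by residues in each variable gives the blocks W A Wᵀ and W B
with W = `residueMatrix x`, and det W = 1/Δ. -/
theorem pfaffianRatio_eq (hr : IsAdmissible χ A B r) (h : P + Q = 2 * N) (ψ : Fin P → Fin L)
    (C : Matrix (Fin Q) (Fin Q) ℂ) {x : Fin P → ℂ} (hinj : Function.Injective x)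
    (hx : ∀ i, x i ∈ Metric.ball (χ (ψ i)) (r (ψ i))) :
    pfaffianRatio h A B C x = hr.weightFun h C (resolventProd χ r x) := by
  have hxd : ∀ i, x i ∈ discs χ r := fun i =>
    Set.mem_iUnion.mpr ⟨ψ i, Metric.ball_subset_closedBall (hx i)⟩
  have hA1 : ∀ y ∈ discs χ r, DifferentiableOn ℂ (fun z => A z y) (discs χ r) := fun y hy z hz =>
    ((hr.analytic_A (z, y) ⟨hz, hy⟩).comp (f := fun z => (z, y))
      (by fun_prop)).differentiableAt.differentiableWithinAt
  have hA2 : ∀ y ∈ discs χ r, DifferentiableOn ℂ (fun z => A y z) (discs χ r) := fun y hy z hz =>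
    ((hr.analytic_A (y, z) ⟨hy, hz⟩).comp (f := fun z => (y, z))
      (by fun_prop)).differentiableAt.differentiableWithinAt
  rw [pfaffianRatio, ← det_residueMatrix hinj, ← pfaffian_bordered_conj, IsAdmissible.weightFun,
    weightPfaffian]
  congr 2
  · ext α γ
    rw [Matrix.of_apply, mul_comm (resolventProd χ r x), momentCLM_resolventProd hr ψ hinj hx α
      (f := fun z => ∑ j, residueMatrix x γ j * A z (x j))]
    · rw [Matrix.mul_assoc, Matrix.mul_apply]
      refine Finset.sum_congr rfl fun i _ => ?_
      congr 1
      rw [Matrix.mul_apply]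
      exact Finset.sum_congr rfl fun j _ => mul_comm _ _
    · exact DifferentiableOn.fun_sum fun j _ => (hA1 _ (hxd j)).const_mul _
    · intro z
      rw [kernelCLM_apply]
      exact momentCLM_resolventProd hr ψ hinj hx γ (hA2 _ (circles_subset_discs hr.pos z.2))
        (hr.kernel_apply z)
  · ext α e
    rw [Matrix.of_apply, momentCLM_resolventProd hr ψ hinj hx α
      (hr.analytic_B e).differentiableOn fun _ => rfl, Matrix.mul_apply]
    rfl

/-! ### Existence of the two limits -/

theorem isOpen_setOf_injective (P : ℕ) : IsOpen {x : Fin P → ℂ | Function.Injective x} := by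
  simp only [← Matrix.det_vandermonde_ne_zero_iff]
  refine isOpen_ne_fun (Continuous.matrix_det ?_) continuous_const
  refine continuous_matrix fun i j => ?_
  simp only [Matrix.vandermonde_apply]
  fun_prop

/-- The points x_i + s i have distinct coordinates for small s ≠ 0. Uniqueness of the left-hand
limit rests on this. -/
theorem nhdsWithin_setOf_injective_neBot {P : ℕ} (x : Fin P → ℂ) :
    (𝓝[{x : Fin P → ℂ | Function.Injective x}] x).NeBot := by
  have h1 : ∀ᶠ s : ℂ in 𝓝[≠] 0, Function.Injective fun i => x i + s * ((i : ℕ) : ℂ) := by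
    have : ∀ i j : Fin P, i ≠ j →
        ∀ᶠ s : ℂ in 𝓝[≠] 0, x i + s * ((i : ℕ) : ℂ) ≠ x j + s * ((j : ℕ) : ℂ) := by
      intro i j hij
      by_cases hx : x i = x j
      · filter_upwards [self_mem_nhdsWithin] with s hs h
        rw [hx, add_right_inj] at h
        exact hij (Fin.ext (Nat.cast_injective (mul_left_cancel₀ hs h)))
      · have hc : Continuous fun s : ℂ => x i + s * ((i : ℕ) : ℂ) - (x j + s * ((j : ℕ) : ℂ)) := by
          fun_prop
        have h0 := hc.continuousAt.eventually_ne (x := 0) (y := 0)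
          (by simpa using sub_ne_zero.mpr hx)
        exact nhdsWithin_le_nhds (h0.mono fun s hs => sub_ne_zero.mp hs)
    filter_upwards [eventually_all.mpr fun i => eventually_all.mpr fun j =>
      eventually_all.mpr fun hij => this i j hij] with s hs i j h
    by_contra hij
    exact hs i j hij h
  have h2 : Tendsto (fun s : ℂ => fun i => x i + s * ((i : ℕ) : ℂ)) (𝓝[≠] 0)
      (𝓝[{x : Fin P → ℂ | Function.Injective x}] x) := by
    refine tendsto_nhdsWithin_iff.mpr ⟨?_, h1⟩
    have h : Continuous fun s : ℂ => fun i : Fin P => x i + s * ((i : ℕ) : ℂ) := by fun_prop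
    have h0 := h.tendsto 0
    simp only [zero_mul, add_zero] at h0
    exact h0.mono_left nhdsWithin_le_nhds
  exact h2.neBot

theorem eventually_forall_mem_ball (hr : IsAdmissible χ A B r) (ψ : Fin P → Fin L) :
    ∀ᶠ x : Fin P → ℂ in 𝓝 (fun i => χ (ψ i)), ∀ i, x i ∈ Metric.ball (χ (ψ i)) (r (ψ i)) :=
  eventually_all.mpr fun i => (continuous_apply i).continuousAt.eventually
    (Metric.ball_mem_nhds _ (hr.pos _))

theorem eventually_pfaffianRatio_eventuallyEq (hr : IsAdmissible χ A B r) (h : P + Q = 2 * N)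
    (ψ : Fin P → Fin L) (C : Matrix (Fin Q) (Fin Q) ℂ) :
    ∀ᶠ x in 𝓝[{x : Fin P → ℂ | Function.Injective x}] (fun i => χ (ψ i)),
      pfaffianRatio h A B C =ᶠ[𝓝 x] fun x => hr.weightFun h C (resolventProd χ r x) := by
  filter_upwards [nhdsWithin_le_nhds (eventually_forall_mem_ball hr ψ).eventually_nhds,
    self_mem_nhdsWithin] with x hx hinj
  filter_upwards [hx, (isOpen_setOf_injective P).mem_nhds hinj] with y hy hyinj
  exact pfaffianRatio_eq hr h ψ C hyinj hy

theorem contDiffAt_weightFun_resolventProd (hr : IsAdmissible χ A B r) (h : P + Q = 2 * N)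
    (ψ : Fin P → Fin L) (C : Matrix (Fin Q) (Fin Q) ℂ) :
    ContDiffAt ℂ ω (fun x : Fin P → ℂ => hr.weightFun h C (resolventProd χ r x))
      (fun i => χ (ψ i)) :=
  ContDiffAt.comp _ (contDiff_weightPfaffian h _ _ _ C).contDiffAt
    (contDiffAt_resolventProd fun i => hr.center_notMem (ψ i))

theorem eventually_analyticAt_pfaffianRatio (hr : IsAdmissible χ A B r) (h : P + Q = 2 * N)
    (ψ : Fin P → Fin L) (C : Matrix (Fin Q) (Fin Q) ℂ) :
    ∀ᶠ x in 𝓝[{x : Fin P → ℂ | Function.Injective x}] (fun i => χ (ψ i)),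
      AnalyticAt ℂ (pfaffianRatio h A B C) x := by
  filter_upwards [eventually_pfaffianRatio_eventuallyEq hr h ψ C, nhdsWithin_le_nhds
    ((contDiffAt_weightFun_resolventProd hr h ψ C).eventually (by simp))] with x h1 h2
  exact h2.analyticAt.congr h1.symm

theorem contDiff_transformedPfaffian (hr : IsAdmissible χ A B r) (h : P + Q = 2 * N)
    (ψ : Fin P → Fin L) (C : Matrix (Fin Q) (Fin Q) ℂ) :
    ContDiff ℂ ω (transformedPfaffian (d := d) h ψ χ r A B C) := by
  rw [funext (transformedPfaffian_eq hr h ψ C)]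
  exact (contDiff_weightPfaffian h _ _ _ C).comp (contDiff_expWeight _ _)

variable (hr : IsAdmissible χ A B r) (h : P + Q = 2 * N) (ψ : Fin P → Fin L)
  (C : Matrix (Fin Q) (Fin Q) ℂ) (d : ℕ) (n : Fin P → ℕ)

/-- The common value of the two limits. -/
noncomputable def IsAdmissible.limitValue : ℂ :=
  jetList d (fun i => Ring.inverse (coordFun χ r - χ (ψ i) • 1)) n (List.finRange P)
    (hr.weightFun h C) (resolventProd χ r fun i => χ (ψ i))

variable {d n} (hn : ∀ i, n i ≤ d)
include hn

theorem tendsto_partialDeriv_pfaffianRatio :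
    Tendsto (compAll (fun i : Fin P => (partialDeriv i)^[n i]) (pfaffianRatio h A B C))
      (𝓝[{x : Fin P → ℂ | Function.Injective x}] (fun i => χ (ψ i)))
      (𝓝 (hr.limitValue h ψ C d n)) := by
  rw [compAll_iterate_partialDeriv]
  set f : (Fin P → ℂ) → ℂ := fun x => hr.weightFun h C (resolventProd χ r x) with hf
  have hW : ∀ i, ∀ᶠ x in 𝓝 (fun i => χ (ψ i)), x i = χ (ψ i) → ∀ᶠ t in 𝓝 (0 : ℂ),
      resolventProd χ r (Function.update x i (x i + t)) *
        (1 - t • Ring.inverse (coordFun χ r - χ (ψ i) • 1)) = resolventProd χ r x := by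
    intro i
    filter_upwards [eventually_forall_mem_ball hr ψ] with x hx hxi
    have ht : ∀ᶠ t : ℂ in 𝓝 0, x i + t ∈ Metric.ball (χ (ψ i)) (r (ψ i)) := by
      have : Tendsto (fun t : ℂ => x i + t) (𝓝 0) (𝓝 (x i)) := by
        have h : Continuous fun t : ℂ => x i + t := by fun_prop
        simpa using h.tendsto 0
      exact this.eventually (Metric.isOpen_ball.mem_nhds (hx i))
    filter_upwards [ht] with t ht
    rw [← hxi]
    exact resolventProd_update_mul
      (fun j => notMem_circles_of_mem_ball hr.pos hr.disjoint (hx j))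
      (notMem_circles_of_mem_ball hr.pos hr.disjoint ht)
  -- At the limit point itself all coordinates are pinned, so the jet formula holds for the full
  -- list of variables.
  have hval : partialList n (List.finRange P) f (fun i => χ (ψ i)) = hr.limitValue h ψ C d n :=
    (partialList_comp_eq_jetList hn (List.nodup_finRange P)
      (contDiff_weightPfaffian h _ _ _ C) hW).self_of_nhds fun _ _ => rfl
  have hcont : Tendsto (partialList n (List.finRange P) f) (𝓝 (fun i => χ (ψ i)))
      (𝓝 (hr.limitValue h ψ C d n)) := by
    rw [← hval]
    exact (contDiffAt_partialList (contDiffAt_weightFun_resolventProd hr h ψ C)).continuousAt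
  refine (hcont.mono_left nhdsWithin_le_nhds).congr' ?_
  filter_upwards [eventually_pfaffianRatio_eventuallyEq hr h ψ C] with x hx
  exact (eventuallyEq_partialList hx).symm.self_of_nhds

theorem tendsto_derivOp_transformedPfaffian :
    Tendsto (compAll (fun l : Fin L => compAll (fun k : Fin d =>
        (derivOp l ((k : ℕ) + 1))^[mult ψ n l ((k : ℕ) + 1)]))
      (transformedPfaffian (d := d) h ψ χ r A B C)) (𝓝 0) (𝓝 (hr.limitValue h ψ C d n)) := by
  have hΦ : ContDiff ℂ ω (hr.weightFun h C) := contDiff_weightPfaffian h _ _ _ C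
  set a : Fin L → C(circles χ r, ℂ) := fun l => Ring.inverse (coordFun χ r - χ l • 1) with ha
  set w₀ := resolventProd χ r fun i => χ (ψ i)
  have hf : transformedPfaffian (d := d) h ψ χ r A B C = entireComp d a w₀ hΦ :=
    funext (transformedPfaffian_eq hr h ψ C)
  have hop : Restricts (compAll (fun l : Fin L => compAll (fun k : Fin d =>
      (derivOp l ((k : ℕ) + 1))^[mult ψ n l ((k : ℕ) + 1)])))
      (symbolOp (Fin L × Fin d)
        (∏ l : Fin L, ∏ k : Fin d, blockSymbol d l ((k : ℕ) + 1) ^ mult ψ n l ((k : ℕ) + 1))) :=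
    Restricts.compAll fun l => Restricts.compAll fun k => by
      rw [map_pow]
      exact (restricts_derivOp l _).iterate _
  rw [hf, hop, ← prod_blockSymbol_eq ψ hn, symbolOp_prod_entireComp]
  have hzero : expWeight d a w₀ 0 = w₀ := by simp [expWeight]
  have hlim := ((contDiff_coe (entireComp d a w₀ (contDiff_jetList (d := d)
    (a := fun i => a (ψ i)) (n := n) (l := List.finRange P) hΦ))).continuous).tendsto 0
  have hval : (entireComp d a w₀ (contDiff_jetList (d := d) (a := fun i => a (ψ i)) (n := n)
      (l := List.finRange P) hΦ) : (Fin L × Fin d → ℂ) → ℂ) 0 = hr.limitValue h ψ C d n := by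
    simp only [entireComp, hzero]
    rfl
  rwa [hval] at hlim

end Admissible

/-! ### Small circles, and the theorem -/

theorem exists_isAdmissible {Q L : ℕ} {χ : Fin L → ℂ} (hχ : Function.Injective χ)
    {A : ℂ → ℂ → ℂ} (hA : ∀ l l', AnalyticAt ℂ (fun p : ℂ × ℂ => A p.1 p.2) (χ l, χ l'))
    {B : Fin Q → ℂ → ℂ} (hB : ∀ b l, AnalyticAt ℂ (B b) (χ l)) :
    ∃ δ > 0, ∀ r : Fin L → ℝ, (∀ l, 0 < r l ∧ r l < δ) → IsAdmissible χ A B r := by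
  have h1 : ∀ l l', ∀ᶠ ε : ℝ in 𝓝[>] 0, ∀ p ∈ Metric.closedBall (χ l, χ l') ε,
      AnalyticAt ℂ (fun p : ℂ × ℂ => A p.1 p.2) p := fun l l' => nhdsWithin_le_nhds
    (eventually_closedBall_subset (hA l l').eventually_analyticAt)
  have h2 : ∀ b l, ∀ᶠ ε : ℝ in 𝓝[>] 0, ∀ z ∈ Metric.closedBall (χ l) ε, AnalyticAt ℂ (B b) z :=
    fun b l => nhdsWithin_le_nhds (eventually_closedBall_subset (hB b l).eventually_analyticAt)
  have h3 : ∀ l l', l ≠ l' → ∀ᶠ ε : ℝ in 𝓝[>] 0, ε < dist (χ l) (χ l') / 2 := fun l l' hl =>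
    nhdsWithin_le_nhds (eventually_lt_nhds (half_pos (dist_pos.mpr (hχ.ne hl))))
  obtain ⟨δ, ⟨⟨h1, h2⟩, h3⟩, hδ⟩ := (((eventually_all.mpr fun l => eventually_all.mpr (h1 l)).and
    (eventually_all.mpr fun b => eventually_all.mpr (h2 b))).and
    (eventually_all.mpr fun l => eventually_all.mpr fun l' => eventually_all.mpr (h3 l l'))).and
    self_mem_nhdsWithin |>.exists
  refine ⟨δ, hδ, fun r hr => ⟨fun l => (hr l).1, fun l l' hl => ?_, ?_, fun b z hz => ?_⟩⟩
  · refine Metric.closedBall_disjoint_closedBall ?_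
    linarith [h3 l l' hl, (hr l).2, (hr l').2]
  · rintro ⟨z, w⟩ ⟨hz, hw⟩
    obtain ⟨l, hl⟩ := Set.mem_iUnion.mp hz
    obtain ⟨l', hl'⟩ := Set.mem_iUnion.mp hw
    refine h1 l l' (z, w) ?_
    rw [← closedBall_prod_same]
    exact ⟨Metric.closedBall_subset_closedBall (hr l).2.le hl,
      Metric.closedBall_subset_closedBall (hr l').2.le hl'⟩
  · obtain ⟨l, hl⟩ := Set.mem_iUnion.mp hz
    exact h2 b l z (Metric.closedBall_subset_closedBall (hr l).2.le hl)

end PfDeriv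

theorem theorem1 {P Q N L : ℕ} (hPQ : P + Q = 2 * N) (hN : 0 < N)
    (ψ : Fin P → Fin L) (hψ : Function.Surjective ψ)
    (χ : Fin L → ℂ) (hχ : Function.Injective χ)
    (d : ℕ) (n : Fin P → ℕ) (hn : ∀ i, n i ≤ d)
    (C : Matrix (Fin Q) (Fin Q) ℂ) (hC : C.transpose = -C)
    (A : ℂ → ℂ → ℂ) (hA : ∀ x y, A x y = -A y x)
    (hA_an : ∀ l l', AnalyticAt ℂ (fun p : ℂ × ℂ => A p.1 p.2) (χ l, χ l'))
    (B : Fin Q → ℂ → ℂ) (hB_an : ∀ b l, AnalyticAt ℂ (B b) (χ l)) :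
    -- the ratio is analytic at all points with pairwise distinct coordinates close to the limit
    (∀ᶠ x in 𝓝[{x : Fin P → ℂ | Function.Injective x}] (fun i => χ (ψ i)),
      AnalyticAt ℂ (PfDeriv.pfaffianRatio hPQ A B C) x) ∧
    -- all sufficiently small circles around the limiting points are admissible
    (∃ δ > 0, ∀ r : Fin L → ℝ, (∀ l, 0 < r l ∧ r l < δ) → PfDeriv.IsAdmissible χ A B r) ∧
    -- for admissible circles the transformed Pfaffian is entire in `u`
    (∀ r : Fin L → ℝ, PfDeriv.IsAdmissible χ A B r →
      AnalyticOnNhd ℂ (PfDeriv.transformedPfaffian (d := d) hPQ ψ χ r A B C) Set.univ) ∧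
    -- both limits exist and agree
    ∃ v : ℂ,
      Tendsto
        (PfDeriv.compAll (fun i : Fin P => (PfDeriv.partialDeriv i)^[n i])
          (PfDeriv.pfaffianRatio hPQ A B C))
        (𝓝[{x : Fin P → ℂ | Function.Injective x}] (fun i => χ (ψ i))) (𝓝 v) ∧
      ∀ r : Fin L → ℝ, PfDeriv.IsAdmissible χ A B r →
        Tendsto
          (PfDeriv.compAll
            (fun l : Fin L => PfDeriv.compAll
              (fun k : Fin d =>
                (PfDeriv.derivOp l ((k : ℕ) + 1))^[PfDeriv.mult ψ n l ((k : ℕ) + 1)]))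
            (PfDeriv.transformedPfaffian (d := d) hPQ ψ χ r A B C))
          (𝓝 0) (𝓝 v) := by
  obtain ⟨δ, hδ, hadm⟩ := PfDeriv.exists_isAdmissible hχ hA_an hB_an
  have hr₀ : PfDeriv.IsAdmissible χ A B fun _ => δ / 2 :=
    hadm _ fun _ => ⟨half_pos hδ, half_lt_self hδ⟩
  have hlim := fun (r : Fin L → ℝ) (hr : PfDeriv.IsAdmissible χ A B r) =>
    PfDeriv.tendsto_partialDeriv_pfaffianRatio hr hPQ ψ C hn
  refine ⟨PfDeriv.eventually_analyticAt_pfaffianRatio hr₀ hPQ ψ C, ⟨δ, hδ, hadm⟩,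
    fun r hr => contDiff_omega_iff_analyticOnNhd.mp
      (PfDeriv.contDiff_transformedPfaffian hr hPQ ψ C),
    hr₀.limitValue hPQ ψ C d n, hlim _ hr₀, fun r hr => ?_⟩
  -- `limitValue` is built from r, but for every admissible r it is the limit of the same ratio,
  -- which does not involve r.
  have := PfDeriv.nhdsWithin_setOf_injective_neBot fun i => χ (ψ i)
  rw [tendsto_nhds_unique (hlim _ hr₀) (hlim r hr)]
  exact PfDeriv.tendsto_derivOp_transformedPfaffian hr hPQ ψ C hn
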